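/- Let $m_1,m_2$ be given and let $v(x,t)$ be an $m_1\times m_2$ matrix function which is continuously differentiable on the quarter-plane $\Omega_\infty=\{(x,t): 0\le x<\infty,\ 0\le t<\infty\}$ (with one-sided derivatives on the boundary), for which $v_{xx}$ exists on $\Omega_\infty$, and which satisfies the focusing matrix nonlinear Schrödinger equation $$2v_t+\mathrm{i}\,(v_{xx}+2vv^*v)=0 .$$ Assume that, in the spectral norm and for some $M>0$, $$\sup_{(x,t)\in\Omega_\infty}\|v(x,t)\|\le M,\qquad \sup_{t>0}\|v_x(0,t)\|<\infty,\qquad \sup_{x\ge 0,\ 0\le t<c}\|v_x(x,t)\|<\infty\ \text{ for each } c>0 .$$ Put $$j=\begin{bmatrix} I_{m_1}&0\\0&-I_{m_2}\end{bmatrix},\quad V=\begin{bmatrix}0&v\\v^*&0\end{bmatrix},\quad G=\mathrm{i}zj+jV,\quad F=\mathrm{i}\big(z^2j-\mathrm{i}zjV-(V_x+jV^2)/2\big).$$ For $z\in\mathbb C$ let $u(x,z)$ $(x\ge0)$ be the solution of the skew-selfadjoint Dirac system $u_x=G(x,0,z)u$, $u(0,z)=I_{m_1+m_2}$, and let $R(t,z)=\{R_{ik}(t,z)\}_{i,k=1}^2$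 $(t\ge0)$, with $m_i\times m_k$ blocks $R_{ik}$, be the solution of $R_t=F(0,t,z)R$, $R(0,z)=I_{m_1+m_2}$. A generalized Weyl function (GW-function) of the system at $t=0$ on a half-plane $\mathbb C_K=\{z:\operatorname{Im}z>K\}$, $K>0$, is an $m_2\times m_1$ matrix function $\varphi(0,z)$, holomorphic in $\mathbb C_K$, such that $$\sup_{0\le x\le l,\ z\in\mathbb C_K}\left\|\mathrm{e}^{-\mathrm{i}zx}u(x,z)\begin{bmatrix}I_{m_1}\\ \varphi(0,z)\end{bmatrix}\right\|<\infty\quad\text{for each } l<\infty .$$ Then a GW-function of the system at $t=0$ exists on $\mathbb C_M$, and there are $M_1>M$ and $M_2>0$ (depending on $v$) such that, for every $K>0$ and every GW-function $\varphi(0,\cdot)$ on $\mathbb C_K$, at each $z$ with $\operatorname{Im}z>M_1$, $\operatorname{Re}z>M_2$ and $\operatorname{Im}z>K$, the matrix $R_{22}(t,z)$ is invertible for all $t\ge0$ and $$\varphi(0,z)=-\lim_{t\to\infty}R_{22}(t,z)^{-1}R_{21}(t,z).$$ -/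

import Mathlib

/- Matrices carry the spectral norm (operator norm for the Euclidean norms). -/
open scoped Matrix Matrix.Norms.L2Operator

/-- Block matrices of size `(m₁ + m₂) × (m₁ + m₂)`. -/
abbrev BlockMat (m₁ m₂ : ℕ) := Matrix (Fin m₁ ⊕ Fin m₂) (Fin m₁ ⊕ Fin m₂) ℂ

/-- The signature matrix `j = diag(I_{m₁}, -I_{m₂})`. -/
def signMat (m₁ m₂ : ℕ) : BlockMat m₁ m₂ := Matrix.fromBlocks 1 0 0 (-1)

/-- The potential `V = [[0, v], [v*, 0]]`. -/
def potential {m₁ m₂ : ℕ} (v : Matrix (Fin m₁) (Fin m₂) ℂ) : BlockMat m₁ m₂ :=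
  Matrix.fromBlocks 0 v vᴴ 0

/-- `G = i z j + j V`. -/
def coeffG {m₁ m₂ : ℕ} (z : ℂ) (v : Matrix (Fin m₁) (Fin m₂) ℂ) : BlockMat m₁ m₂ :=
  (Complex.I * z) • signMat m₁ m₂ + signMat m₁ m₂ * potential v

/-- `F = i (z² j - i z j V - (V_x + j V²) / 2)`, as a function of the values of `v` and `v_x`. -/
noncomputable def coeffF {m₁ m₂ : ℕ} (z : ℂ) (v vx : Matrix (Fin m₁) (Fin m₂) ℂ) :
    BlockMat m₁ m₂ :=
  Complex.I • (z ^ 2 • signMat m₁ m₂ - (Complex.I * z) • (signMat m₁ m₂ * potential v)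
    - (1 / 2 : ℂ) • (potential vx + signMat m₁ m₂ * potential v ^ 2))

/-- `Y` is the fundamental solution of `Y' = A Y` on `[0, ∞)` normalized by `Y(0) = I`
(one-sided derivative at `0`). -/
def IsFundamentalSolution {m₁ m₂ : ℕ} (A Y : ℝ → BlockMat m₁ m₂) : Prop :=
  Y 0 = 1 ∧ ∀ s, 0 ≤ s → HasDerivWithinAt Y (A s * Y s) (Set.Ici 0) s

/-- The open half-plane `ℂ_K = {z : Im z > K}`. -/
def upperHalf (K : ℝ) : Set ℂ := {z | K < z.im}

/-- `φ` is, on the half-plane `ℂ_K`, a generalized Weyl function of the skew-selfadjoint Dirac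
system `y' = (i z j + j V(x)) y`, `x ≥ 0`: it is holomorphic in `ℂ_K` and, `u` being the normalized
fundamental solution, `e^{-izx} u(x, z) [I; φ(z)]` is bounded on `[0, l] × ℂ_K` for each `l`. -/
def IsGWFunctionOn {m₁ m₂ : ℕ} (K : ℝ) (v : ℝ → Matrix (Fin m₁) (Fin m₂) ℂ)
    (φ : ℂ → Matrix (Fin m₂) (Fin m₁) ℂ) : Prop :=
  DifferentiableOn ℂ φ (upperHalf K) ∧
  ∃ u : ℂ → ℝ → BlockMat m₁ m₂,
    (∀ z, IsFundamentalSolution (fun x => coeffG z (v x)) (u z)) ∧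
    ∀ l : ℝ, ∃ C : ℝ, ∀ x ∈ Set.Icc 0 l, ∀ z ∈ upperHalf K,
      ‖Complex.exp (-(Complex.I * z * (x : ℂ))) •
        (u z x * Matrix.fromRows (1 : Matrix (Fin m₁) (Fin m₁) ℂ) (φ z))‖ ≤ C

/-- The partial derivative `v_x(x, t)` for `x ≥ 0` (one-sided at `x = 0`). -/
noncomputable def partialX {m₁ m₂ : ℕ} (v : ℝ → ℝ → Matrix (Fin m₁) (Fin m₂) ℂ) (x t : ℝ) :
    Matrix (Fin m₁) (Fin m₂) ℂ :=
  derivWithin (fun ξ => v ξ t) (Set.Ici 0) x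

/-- The partial derivative `v_t(x, t)` for `t ≥ 0` (one-sided at `t = 0`). -/
noncomputable def partialT {m₁ m₂ : ℕ} (v : ℝ → ℝ → Matrix (Fin m₁) (Fin m₂) ℂ) (x t : ℝ) :
    Matrix (Fin m₁) (Fin m₂) ℂ :=
  derivWithin (fun τ => v x τ) (Set.Ici 0) t

/-- `v` is continuously differentiable on the closed quarter-plane, `v_xx` exists there, and `v`
satisfies the focusing matrix NLS equation `2 v_t + i (v_xx + 2 v v* v) = 0`. -/
structure IsFocusingNLSSolution {m₁ m₂ : ℕ} (v : ℝ → ℝ → Matrix (Fin m₁) (Fin m₂) ℂ) : Prop where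
  contDiffOn : ContDiffOn ℝ 1 (Function.uncurry v) (Set.Ici 0 ×ˢ Set.Ici 0)
  differentiable_partialX : ∀ x t, 0 ≤ x → 0 ≤ t →
    DifferentiableWithinAt ℝ (fun ξ => partialX v ξ t) (Set.Ici 0) x
  equation : ∀ x t, 0 ≤ x → 0 ≤ t →
    (2 : ℂ) • partialT v x t +
      Complex.I • (partialX (partialX v) x t + (2 : ℂ) • (v x t * (v x t)ᴴ * v x t)) = 0

/-! ### Linear differential equations in a Banach algebra: existence, uniqueness, dependence on a
parameter -/

section LinearODE

open Set MeasureTheory intervalIntegral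

/-! Everything rests on the indefinite form `energy w` = ‖w₂‖² - ‖w₁‖². Up to coupling terms of size
μ, both coefficients damp w₁ and amplify w₂ at a rate β (`IsDichotomic`): for G, β = Im z and μ = M;
for F at x = 0, β = 2 Re z Im z and μ = |z| M + C/2, where C bounds v_x(0, t). When β > μ, positive
energy grows at rate 2(β - μ), so the cone of nonpositive energy is invariant backwards; vectors
that stay in it have a first component decaying like e^{-(β-μ)s}, and vectors [0; h] expand like
e^{(β-μ)s}. Hence if φ makes all [h; φh] stay in the cone, then -Y₂₂⁻¹Y₂₁, whose graph is sent by
Y(T) to vectors with vanishing second component, lies within e^{-2(β-μ)T} of φ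
(`norm_truncatedWeyl_sub_le`).

Applied to G, this gives a Cauchy family of truncations whose limit is a GW-function on ℂ_M
(`exists_weylFunction`). Any other GW-function agrees with it: their difference decays faster than
every exponential in Im z, so it vanishes by Phragmén–Lindelöf (`gwFunction_unique`).

Applied to F, it reduces the recovery formula to one fact: R(t, z)[h; φ(0, z)h] has nonpositive
energy for every t (`IsFocusingNLSSolution.energy_actVec_nonpos`). The NLS equation is the zero
curvature condition G_t - F_x + [G, F] = 0, so the x-flow at time T started from R(T) reaches at x =
X the same matrix as the t-flow at X started from u(X). If the energy of R(T)w were positive, the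
x-flow at time T would keep it bounded below; but the t-flow multiplies u(X)w by at most a constant
independent of X, and u(X)w → 0. -/

theorem norm_le_exp_mul_of_norm_deriv_le {E : Type*} [NormedAddCommGroup E] [NormedSpace ℝ E]
    {f f' : ℝ → E} {K T : ℝ} (hT : 0 ≤ T)
    (hf : ∀ s ∈ Icc 0 T, HasDerivWithinAt f (f' s) (Ici 0) s)
    (hK : ∀ s ∈ Icc 0 T, ‖f' s‖ ≤ K * ‖f s‖) : ‖f T‖ ≤ Real.exp (K * T) * ‖f 0‖ := by
  have h := norm_le_gronwallBound_of_norm_deriv_right_le (f := f) (f' := f') (δ := ‖f 0‖) (K := K)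
    (ε := 0) (a := 0) (b := T)
    (fun s hs => (hf s hs).continuousWithinAt.mono Icc_subset_Ici_self)
    (fun s hs => (hf s (Ico_subset_Icc_self hs)).mono (Ici_subset_Ici.2 hs.1)) le_rfl
    (fun s hs => by simpa using hK s (Ico_subset_Icc_self hs)) T ⟨hT, le_rfl⟩
  rw [gronwallBound_ε0, sub_zero] at h
  linarith

theorem eqOn_Icc_of_linear_ode {E : Type*} [NormedAddCommGroup E] [NormedSpace ℝ E]
    {L : ℝ → E → E} {f g : ℝ → E} {K T : ℝ}
    (hf : ∀ s ∈ Icc 0 T, HasDerivWithinAt f (L s (f s)) (Ici 0) s)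
    (hg : ∀ s ∈ Icc 0 T, HasDerivWithinAt g (L s (g s)) (Ici 0) s)
    (hL : ∀ s ∈ Icc 0 T, ∀ x y, ‖L s x - L s y‖ ≤ K * ‖x - y‖) (h0 : f 0 = g 0) :
    EqOn f g (Icc 0 T) := by
  intro t ht
  have h := norm_le_exp_mul_of_norm_deriv_le (f := fun s => f s - g s) (K := K) ht.1
    (fun s hs => (hf s ⟨hs.1, hs.2.trans ht.2⟩).sub (hg s ⟨hs.1, hs.2.trans ht.2⟩))
    (fun s hs => hL s ⟨hs.1, hs.2.trans ht.2⟩ _ _)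
  simp only [h0, sub_self, norm_zero, mul_zero] at h
  exact sub_eq_zero.1 (norm_le_zero_iff.1 h)

variable {E : Type*} [NormedAddCommGroup E] [NormedSpace ℂ E]

/-- The primitive vanishing at `0`, as an operator on `C([0, X], E)`. -/
noncomputable def primitiveCLM {X : ℝ} (hX : 0 ≤ X) : C(Icc 0 X, E) →L[ℂ] C(Icc 0 X, E) :=
  LinearMap.mkContinuous
    { toFun := fun f => ⟨fun x => ∫ s in (0 : ℝ)..x, IccExtend hX f s,
        (continuous_primitive (fun a b => (f.continuous.Icc_extend' (h := hX)).intervalIntegrable a b)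
          0).comp continuous_subtype_val⟩
      map_add' := fun f g => by
        ext x
        exact integral_add (f.continuous.Icc_extend'.intervalIntegrable _ _)
          (g.continuous.Icc_extend'.intervalIntegrable _ _)
      map_smul' := fun c f => by
        ext x
        exact intervalIntegral.integral_smul c _ }
    X (fun f => by
      refine (ContinuousMap.norm_le _ (by positivity)).2 fun x => ?_
      have h : ∀ s ∈ uIoc (0 : ℝ) x, ‖IccExtend hX f s‖ ≤ ‖f‖ := fun s _ => f.norm_coe_le_norm _
      refine (norm_integral_le_of_norm_le_const h).trans ?_
      rw [sub_zero, abs_of_nonneg x.2.1, mul_comm]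
      gcongr
      exact x.2.2)

theorem primitiveCLM_apply {X : ℝ} (hX : 0 ≤ X) (f : C(Icc 0 X, E)) (x : Icc 0 X) :
    primitiveCLM hX f x = ∫ s in (0 : ℝ)..x, IccExtend hX f s := rfl

theorem primitiveCLM_apply_of_eqOn {X : ℝ} (hX : 0 ≤ X) (f : C(Icc 0 X, E)) {g : ℝ → E}
    (hg : ∀ s : Icc 0 X, f s = g s) (x : Icc 0 X) :
    primitiveCLM hX f x = ∫ s in (0 : ℝ)..x, g s := by
  rw [primitiveCLM_apply]
  refine integral_congr fun s hs => ?_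
  rw [uIcc_of_le x.2.1] at hs
  have hs' : s ∈ Icc 0 X := ⟨hs.1, hs.2.trans x.2.2⟩
  simp only [IccExtend_of_mem hX f hs', hg]

variable {A : Type*} [NormedRing A] [NormedAlgebra ℂ A]

/-- The Volterra operator `f ↦ ∫ a f` on `C([0, X], A)`. -/
noncomputable def volterraCLM {X : ℝ} (hX : 0 ≤ X) (a : C(Icc 0 X, A)) :
    C(Icc 0 X, A) →L[ℂ] C(Icc 0 X, A) :=
  (primitiveCLM hX).comp (ContinuousLinearMap.mul ℂ C(Icc 0 X, A) a)

/-- The factorial gained by iterated integration makes some power of the operator a strict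
contraction, however long the interval and however large `a`. -/
theorem norm_volterraCLM_pow_apply_le {X : ℝ} (hX : 0 ≤ X) (a f : C(Icc 0 X, A)) (n : ℕ)
    (x : Icc 0 X) :
    ‖(volterraCLM hX a ^ n) f x‖ ≤ (‖a‖ * x) ^ n / n.factorial * ‖f‖ := by
  induction n generalizing x with
  | zero => simpa using f.norm_coe_le_norm x
  | succ n ih =>
    rw [pow_succ', mul_apply_eq_comp]
    set g := (volterraCLM hX a ^ n) f
    have hle : ∀ s ∈ Ioc (0 : ℝ) x, ‖IccExtend hX (a * g) s‖ ≤
        ‖a‖ ^ (n + 1) / n.factorial * ‖f‖ * s ^ n := by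
      intro s hs
      have hs' : s ∈ Icc 0 X := ⟨hs.1.le, hs.2.trans x.2.2⟩
      rw [IccExtend_of_mem hX _ hs', ContinuousMap.mul_apply]
      refine (norm_mul_le _ _).trans ?_
      refine (mul_le_mul (a.norm_coe_le_norm _) (ih ⟨s, hs'⟩) (norm_nonneg _)
        (norm_nonneg _)).trans (le_of_eq ?_)
      simp only [mul_pow]
      ring
    change ‖∫ s in (0 : ℝ)..x, IccExtend hX (a * g) s‖ ≤ _
    refine (intervalIntegral.norm_integral_le_of_norm_le x.2.1 (Filter.Eventually.of_forall hle)
      ((continuous_const.mul (continuous_pow n)).intervalIntegrable _ _)).trans (le_of_eq ?_)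
    rw [intervalIntegral.integral_const_mul, integral_pow, Nat.factorial_succ]
    push_cast
    field_simp
    ring

/-- The geometric sum is a cofactor commuting with 1 - x, and commuting factors of a unit are units.
-/
theorem isUnit_one_sub_of_isUnit_one_sub_pow {R : Type*} [Ring R] {x : R} {n : ℕ}
    (h : IsUnit (1 - x ^ n)) : IsUnit (1 - x) := by
  have hc : Commute (1 - x) (∑ i ∈ Finset.range n, x ^ i) :=
    Commute.sum_right _ _ _ fun i _ =>
      ((Commute.one_left _).sub_left (Commute.refl _)).pow_right i
  rw [← mul_neg_geom_sum] at h
  exact (hc.isUnit_mul_iff.1 h).1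

theorem isUnit_one_sub_volterraCLM [CompleteSpace A] {X : ℝ} (hX : 0 ≤ X) (a : C(Icc 0 X, A)) :
    IsUnit (1 - volterraCLM hX a) := by
  have hlim := FloorSemiring.tendsto_pow_div_factorial_atTop (‖a‖ * X)
  obtain ⟨n, hn⟩ := (hlim.eventually_lt_const (one_pos)).exists
  have hpow : IsUnit (1 - volterraCLM hX a ^ n) := by
    refine isUnit_one_sub_of_norm_lt_one (R := C(Icc 0 X, A) →L[ℂ] C(Icc 0 X, A))
      (lt_of_le_of_lt ?_ hn)
    refine ContinuousLinearMap.opNorm_le_bound _ (by positivity) fun f => ?_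
    refine (ContinuousMap.norm_le _ (by positivity)).2 fun x => ?_
    refine (norm_volterraCLM_pow_apply_le hX a f n x).trans ?_
    have h0 := x.2.1
    have h1 := x.2.2
    gcongr
  exact isUnit_one_sub_of_isUnit_one_sub_pow (R := C(Icc 0 X, A) →L[ℂ] C(Icc 0 X, A)) hpow

theorem hasDerivWithinAt_of_eq_integral [CompleteSpace E] {f g : ℝ → E} {c : E} {T : ℝ}
    (hg : ContinuousOn g (Ici 0)) (hf : ∀ s ∈ Icc 0 T, f s = c + ∫ r in (0 : ℝ)..s, g r)
    {s : ℝ} (hs : s ∈ Ico 0 T) : HasDerivWithinAt f (g s) (Ici 0) s := by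
  -- Freezing `g` to the left of 0 gives a continuous function on the line, so the two-sided
  -- fundamental theorem of calculus applies even at s = 0.
  have hG : Continuous fun r => g (max r 0) :=
    hg.comp_continuous (by fun_prop) fun r => mem_Ici.2 (le_max_right _ _)
  have h1 : HasDerivAt (fun s => c + ∫ r in (0 : ℝ)..s, g (max r 0)) (g (max s 0)) s :=
    (integral_hasDerivAt_right (hG.intervalIntegrable _ _)
      (hG.stronglyMeasurableAtFilter _ _) hG.continuousAt).const_add c
  rw [max_eq_left hs.1] at h1
  have heq : ∀ s ∈ Icc 0 T, f s = c + ∫ r in (0 : ℝ)..s, g (max r 0) := by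
    intro s hs
    rw [hf s hs]
    congr 1
    refine integral_congr fun r hr => ?_
    rw [uIcc_of_le hs.1] at hr
    simp only [max_eq_left hr.1]
  refine h1.hasDerivWithinAt.congr_of_eventuallyEq ?_ (heq s ⟨hs.1, hs.2.le⟩)
  filter_upwards [self_mem_nhdsWithin, mem_nhdsWithin_of_mem_nhds (Iio_mem_nhds hs.2)] with r hr hr'
  exact heq r ⟨hr, hr'.le⟩

theorem eq_integral_of_hasDerivWithinAt [CompleteSpace E] {f g : ℝ → E}
    (hg : ContinuousOn g (Ici 0)) (hf : ∀ s, 0 ≤ s → HasDerivWithinAt f (g s) (Ici 0) s)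
    {s : ℝ} (hs : 0 ≤ s) : f s = f 0 + ∫ r in (0 : ℝ)..s, g r := by
  rw [integral_eq_sub_of_hasDeriv_right_of_le hs
    (fun r hr => (hf r hr.1).continuousWithinAt.mono Icc_subset_Ici_self)
    (fun r hr => (hf r hr.1.le).mono (Ioi_subset_Ici hr.1.le))
    ((hg.mono (by rw [uIcc_of_le hs]; exact Icc_subset_Ici_self)).intervalIntegrable)]
  abel

/-- The restriction of `f` to `[0, X]`. -/
def restrictIcc {B : Type*} [TopologicalSpace B] (X : ℝ) (f : ℝ → B) (hf : ContinuousOn f (Ici 0)) :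
    C(Icc 0 X, B) :=
  ⟨fun x => f x, (hf.mono Icc_subset_Ici_self).domRestrict⟩

/-- The solution is (1 - Volterra operator)⁻¹ applied to the constant y₀. The interval is half-open
because the derivative is taken within [0, ∞) and the extension beyond X is constant. -/
theorem exists_linear_ode_Ico [CompleteSpace A] {a : ℝ → A} (ha : ContinuousOn a (Ici 0)) (y₀ : A)
    (X : ℝ) : ∃ y : ℝ → A, y 0 = y₀ ∧ ∀ s ∈ Ico 0 X, HasDerivWithinAt y (a s * y s) (Ici 0) s := by
  rcases lt_or_ge X 0 with hX | hX
  · exact ⟨fun _ => y₀, rfl, fun s hs => absurd (hs.1.trans_lt hs.2) hX.not_gt⟩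
  obtain ⟨w, hw⟩ := isUnit_one_sub_volterraCLM hX (restrictIcc X a ha)
  set f : C(Icc 0 X, A) := (↑w⁻¹ : C(Icc 0 X, A) →L[ℂ] C(Icc 0 X, A)) (ContinuousMap.const _ y₀)
  have hf : f - volterraCLM hX (restrictIcc X a ha) f = ContinuousMap.const _ y₀ := by
    have : (↑w * ↑w⁻¹ : C(Icc 0 X, A) →L[ℂ] C(Icc 0 X, A)) (ContinuousMap.const _ y₀) =
      ContinuousMap.const _ y₀ := by rw [w.mul_inv]; rfl
    rw [hw] at this
    exact this
  have hint : ∀ s ∈ Icc 0 X, IccExtend hX f s = y₀ + ∫ r in (0 : ℝ)..s, a r * IccExtend hX f r := by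
    intro s hs
    have h1 := DFunLike.congr_fun hf ⟨s, hs⟩
    have h2 := primitiveCLM_apply_of_eqOn hX (restrictIcc X a ha * f)
      (g := fun r => a r * IccExtend hX f r) (fun r => by
        rw [ContinuousMap.mul_apply, IccExtend_val]; rfl) ⟨s, hs⟩
    rw [IccExtend_of_mem hX f hs, ← h2]
    exact sub_eq_iff_eq_add.1 h1
  refine ⟨IccExtend hX f, ?_, fun s hs => ?_⟩
  · simpa using hint 0 ⟨le_rfl, hX⟩
  · exact hasDerivWithinAt_of_eq_integral (g := fun r => a r * IccExtend hX f r)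
      (ha.mul f.continuous.Icc_extend'.continuousOn) hint hs

theorem exists_bound_Icc {B : Type*} [SeminormedAddCommGroup B] {a : ℝ → B}
    (ha : ContinuousOn a (Ici 0)) (T : ℝ) : ∃ K, ∀ s ∈ Icc 0 T, ‖a s‖ ≤ K :=
  isCompact_Icc.exists_bound_of_continuousOn (ha.mono Icc_subset_Ici_self)

theorem linear_ode_unique {a f g : ℝ → A} (ha : ContinuousOn a (Ici 0)) {T : ℝ}
    (hf : ∀ s ∈ Icc 0 T, HasDerivWithinAt f (a s * f s) (Ici 0) s)
    (hg : ∀ s ∈ Icc 0 T, HasDerivWithinAt g (a s * g s) (Ici 0) s) (h0 : f 0 = g 0) :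
    EqOn f g (Icc 0 T) := by
  obtain ⟨K, hK⟩ := exists_bound_Icc ha T
  refine eqOn_Icc_of_linear_ode (L := fun s x => a s * x) (K := K) hf hg (fun s hs x y => ?_) h0
  rw [← mul_sub]
  exact (norm_mul_le _ _).trans (by gcongr; exact hK s hs)

theorem exists_linear_ode [CompleteSpace A] {a : ℝ → A} (ha : ContinuousOn a (Ici 0)) (y₀ : A) :
    ∃ y : ℝ → A, y 0 = y₀ ∧ ∀ s, 0 ≤ s → HasDerivWithinAt y (a s * y s) (Ici 0) s := by
  choose y hy0 hy using exists_linear_ode_Ico ha y₀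
  -- The global solution takes at s the value of the solution with horizon s + 1, so that s is
  -- interior; uniqueness makes the horizon immaterial.
  have heq : ∀ X s, 0 ≤ s → s < X → y (s + 1) s = y X s := fun X s hs hsX =>
    linear_ode_unique ha
      (fun r hr => hy (s + 1) r ⟨hr.1, hr.2.trans_lt (lt_add_one s)⟩)
      (fun r hr => hy X r ⟨hr.1, hr.2.trans_lt hsX⟩) (by rw [hy0, hy0]) ⟨hs, le_rfl⟩
  refine ⟨fun s => y (s + 1) s, hy0 _, fun s hs => ?_⟩
  refine (hy (s + 1) s ⟨hs, lt_add_one s⟩).congr_of_eventuallyEq ?_ rfl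
  filter_upwards [self_mem_nhdsWithin, mem_nhdsWithin_of_mem_nhds (Iio_mem_nhds (lt_add_one s))]
    with r hr hr'
  exact heq _ r hr hr'

theorem differentiableAt_ringInverse_one_sub_apply [CompleteSpace E] (P Q : E →L[ℂ] E) (b : E)
    {z : ℂ} (hz : IsUnit (1 - (z • P + Q))) :
    DifferentiableAt ℂ (fun z : ℂ => (Ring.inverse (1 - (z • P + Q)) : E →L[ℂ] E) b) z := by
  have h1 : DifferentiableAt ℂ (fun z : ℂ => 1 - (z • P + Q)) z := by fun_prop
  have h2 : DifferentiableAt ℂ (fun z : ℂ => Ring.inverse (1 - (z • P + Q))) z :=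
    DifferentiableAt.comp (g := (Ring.inverse : (E →L[ℂ] E) → (E →L[ℂ] E))) z
      (differentiableAt_inverse hz) h1
  exact h2.clm_apply (differentiableAt_const b)

/-- As an element of C([0, X], A), the solution is the inverse of 1 - (zP + Q) applied to a
constant, and inversion is holomorphic on units. -/
theorem differentiable_linear_ode [CompleteSpace A] {a b : ℝ → A} (ha : ContinuousOn a (Ici 0))
    (hb : ContinuousOn b (Ici 0)) {y₀ : A} {y : ℂ → ℝ → A} (h0 : ∀ z, y z 0 = y₀)
    (hy : ∀ z s, 0 ≤ s → HasDerivWithinAt (y z) ((z • a s + b s) * y z s) (Ici 0) s)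
    {X : ℝ} (hX : 0 ≤ X) : Differentiable ℂ fun z => y z X := by
  set P := volterraCLM hX (restrictIcc X a ha)
  set Q := volterraCLM hX (restrictIcc X b hb)
  have hc : ∀ z : ℂ, ContinuousOn (fun s => z • a s + b s) (Ici 0) := fun z =>
    (ha.const_smul z).add hb
  have hPQ : ∀ z : ℂ, volterraCLM hX (restrictIcc X _ (hc z)) = z • P + Q := by
    intro z
    have : restrictIcc X _ (hc z) = z • restrictIcc X a ha + restrictIcc X b hb := rfl
    ext1 f
    simp only [volterraCLM, this, P, Q, map_add, map_smul, ContinuousLinearMap.comp_apply,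
      add_apply, smul_apply]
  have hu : ∀ z, IsUnit (1 - (z • P + Q)) := fun z => by
    rw [← hPQ]
    exact isUnit_one_sub_volterraCLM hX _
  have hyc : ∀ z, ContinuousOn (y z) (Ici 0) := fun z s hs => (hy z s hs).continuousWithinAt
  have hsol : ∀ z, restrictIcc X (y z) (hyc z) =
      (Ring.inverse (1 - (z • P + Q)) : C(Icc 0 X, A) →L[ℂ] C(Icc 0 X, A)) (ContinuousMap.const _ y₀) := by
    intro z
    have h1 : (1 - (z • P + Q)) (restrictIcc X (y z) (hyc z)) = ContinuousMap.const _ y₀ := by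
      rw [← hPQ]
      ext1 x
      have h2 := primitiveCLM_apply_of_eqOn hX
        (restrictIcc X _ (hc z) * restrictIcc X (y z) (hyc z))
        (g := fun s => (z • a s + b s) * y z s) (fun s => rfl) x
      have h3 := eq_integral_of_hasDerivWithinAt ((hc z).mul (hyc z)) (hy z) x.2.1
      rw [h0] at h3
      change y z x - primitiveCLM hX
        (restrictIcc X _ (hc z) * restrictIcc X (y z) (hyc z)) x = y₀
      rw [h2, h3]
      exact add_sub_cancel_right _ _
    rw [← h1, ← mul_apply_eq_comp, Ring.inverse_mul_cancel _ (hu z)]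
    rfl
  have heval : (fun z => y z X) = fun z =>
      ContinuousMap.evalCLM ℂ (⟨X, hX, le_rfl⟩ : Icc 0 X)
        ((Ring.inverse (1 - (z • P + Q)) : C(Icc 0 X, A) →L[ℂ] C(Icc 0 X, A)) (ContinuousMap.const _ y₀)) := by
    funext z
    rw [← hsol z]
    rfl
  rw [heval]
  intro z
  exact (ContinuousLinearMap.differentiableAt _).comp z
    (differentiableAt_ringInverse_one_sub_apply P Q _ (hu z))

end LinearODE

/-! ### Growth of the indefinite form under a dichotomy -/

section Energy

open Set

/-- If `f` decays and `g` grows at rate `β`, with coupling of strength `μ ≤ β`, then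
`‖g‖² - ‖f‖²` grows at rate `2 (β - μ)`. -/
theorem exp_mul_energy_le {E₁ E₂ : Type*} [NormedAddCommGroup E₁] [InnerProductSpace ℝ E₁]
    [NormedAddCommGroup E₂] [InnerProductSpace ℝ E₂] {f f' : ℝ → E₁} {g g' : ℝ → E₂} {β μ T : ℝ}
    (hμ : 0 ≤ μ) (hβ : μ ≤ β)
    (hf : ∀ s ∈ Icc 0 T, HasDerivWithinAt f (f' s) (Ici 0) s)
    (hg : ∀ s ∈ Icc 0 T, HasDerivWithinAt g (g' s) (Ici 0) s)
    (hf' : ∀ s ∈ Icc 0 T, inner ℝ (f s) (f' s) ≤ -β * ‖f s‖ ^ 2 + μ * (‖f s‖ * ‖g s‖))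
    (hg' : ∀ s ∈ Icc 0 T, β * ‖g s‖ ^ 2 - μ * (‖f s‖ * ‖g s‖) ≤ inner ℝ (g s) (g' s))
    {r : ℝ} (hr : r ∈ Icc 0 T) :
    Real.exp (2 * (β - μ) * (T - r)) * (‖g r‖ ^ 2 - ‖f r‖ ^ 2) ≤ ‖g T‖ ^ 2 - ‖f T‖ ^ 2 := by
  set c := 2 * (β - μ) with hc
  have hexp : ∀ s, HasDerivAt (fun s => Real.exp (-c * s)) (Real.exp (-c * s) * -c) s := fun s => by
    simpa using ((hasDerivAt_id s).const_mul (-c)).exp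
  have hder : ∀ s ∈ Icc 0 T, HasDerivWithinAt
      (fun s => Real.exp (-c * s) * (‖g s‖ ^ 2 - ‖f s‖ ^ 2))
      (Real.exp (-c * s) * -c * (‖g s‖ ^ 2 - ‖f s‖ ^ 2) +
        Real.exp (-c * s) * (2 * inner ℝ (g s) (g' s) - 2 * inner ℝ (f s) (f' s))) (Ici 0) s :=
    fun s hs => (hexp s).hasDerivWithinAt.mul ((hg s hs).norm_sq.sub (hf s hs).norm_sq)
  have hmono : MonotoneOn (fun s => Real.exp (-c * s) * (‖g s‖ ^ 2 - ‖f s‖ ^ 2)) (Icc 0 T) := by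
    refine monotoneOn_of_hasDerivWithinAt_nonneg (convex_Icc 0 T)
      (fun s hs => (hder s hs).continuousWithinAt.mono Icc_subset_Ici_self)
      (fun s hs => (hder s (interior_subset hs)).mono
        (interior_subset.trans Icc_subset_Ici_self)) fun s hs => ?_
    have h1 := hf' s (interior_subset hs)
    have h2 := hg' s (interior_subset hs)
    -- By `h1` and `h2`, half of the left-hand quantity is at least μ(‖f‖ - ‖g‖)² + 2(β - μ)‖f‖².
    have h3 : 0 ≤ (2 * inner ℝ (g s) (g' s) - 2 * inner ℝ (f s) (f' s)) -
        c * (‖g s‖ ^ 2 - ‖f s‖ ^ 2) := by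
      nlinarith [mul_nonneg hμ (sq_nonneg (‖f s‖ - ‖g s‖)),
        mul_nonneg (sub_nonneg.2 hβ) (sq_nonneg ‖f s‖)]
    calc 0 ≤ Real.exp (-c * s) * ((2 * inner ℝ (g s) (g' s) - 2 * inner ℝ (f s) (f' s)) -
        c * (‖g s‖ ^ 2 - ‖f s‖ ^ 2)) := by positivity
      _ = _ := by ring
  have h := hmono hr ⟨hr.1.trans hr.2, le_rfl⟩ hr.2
  calc Real.exp (c * (T - r)) * (‖g r‖ ^ 2 - ‖f r‖ ^ 2)
      = Real.exp (c * T) * (Real.exp (-c * r) * (‖g r‖ ^ 2 - ‖f r‖ ^ 2)) := by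
        rw [← mul_assoc, ← Real.exp_add]
        ring_nf
    _ ≤ Real.exp (c * T) * (Real.exp (-c * T) * (‖g T‖ ^ 2 - ‖f T‖ ^ 2)) := by gcongr
    _ = ‖g T‖ ^ 2 - ‖f T‖ ^ 2 := by
      rw [← mul_assoc, ← Real.exp_add]
      simp

theorem norm_le_exp_mul_of_inner_le {E : Type*} [NormedAddCommGroup E] [InnerProductSpace ℝ E]
    {f f' : ℝ → E} {c T : ℝ} (hT : 0 ≤ T)
    (hf : ∀ s ∈ Icc 0 T, HasDerivWithinAt f (f' s) (Ici 0) s)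
    (hf' : ∀ s ∈ Icc 0 T, inner ℝ (f s) (f' s) ≤ -c * ‖f s‖ ^ 2) :
    ‖f T‖ ≤ Real.exp (-c * T) * ‖f 0‖ := by
  have hder : ∀ s ∈ Icc 0 T, HasDerivWithinAt (fun s => Real.exp (c * s) • f s)
      (Real.exp (c * s) • f' s + (Real.exp (c * s) * c) • f s) (Ici 0) s := fun s hs => by
    have h : HasDerivAt (fun s => Real.exp (c * s)) (Real.exp (c * s) * c) s := by
      simpa using ((hasDerivAt_id s).const_mul c).exp
    exact h.hasDerivWithinAt.smul (hf s hs)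
  have hanti : AntitoneOn (fun s => ‖Real.exp (c * s) • f s‖ ^ 2) (Icc 0 T) := by
    refine antitoneOn_of_hasDerivWithinAt_nonpos (convex_Icc 0 T)
      (fun s hs => (hder s hs).norm_sq.continuousWithinAt.mono Icc_subset_Ici_self)
      (fun s hs => (hder s (interior_subset hs)).norm_sq.mono
        (interior_subset.trans Icc_subset_Ici_self)) fun s hs => ?_
    have h1 := hf' s (interior_subset hs)
    rw [inner_add_right, inner_smul_left, inner_smul_left, inner_smul_right, inner_smul_right,
      real_inner_self_eq_norm_sq]
    simp only [RCLike.conj_to_real]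
    have : 0 ≤ Real.exp (c * s) * Real.exp (c * s) * (-c * ‖f s‖ ^ 2 - inner ℝ (f s) (f' s)) :=
      mul_nonneg (by positivity) (by linarith)
    linarith
  have h := hanti ⟨le_rfl, hT⟩ ⟨hT, le_rfl⟩ hT
  simp only [mul_zero, Real.exp_zero, one_smul] at h
  have h2 := (pow_le_pow_iff_left₀ (norm_nonneg _) (norm_nonneg _) two_ne_zero).1 h
  rw [norm_smul, Real.norm_eq_abs, abs_of_pos (Real.exp_pos _)] at h2
  calc ‖f T‖ = Real.exp (-c * T) * (Real.exp (c * T) * ‖f T‖) := by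
        rw [← mul_assoc, ← Real.exp_add]
        simp
    _ ≤ _ := by gcongr

end Energy

/-! ### Block vectors and the dichotomy of the two coefficients -/

section BlockVectors

open Set WithLp

/-- The action of a matrix on Euclidean vectors. -/
noncomputable def actVec {m n : Type*} [Fintype n] (A : Matrix m n ℂ) (w : EuclideanSpace ℂ n) :
    EuclideanSpace ℂ m := toLp 2 (A *ᵥ ofLp w)

section

variable {l m n : Type*} [Fintype n]

theorem norm_actVec_le [Fintype m] [DecidableEq n] (A : Matrix m n ℂ) (w : EuclideanSpace ℂ n) :
    ‖actVec A w‖ ≤ ‖A‖ * ‖w‖ := Matrix.l2_opNorm_mulVec A w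

theorem l2_opNorm_le_of_actVec [Fintype m] [DecidableEq n] {A : Matrix m n ℂ} {C : ℝ} (hC : 0 ≤ C)
    (h : ∀ w, ‖actVec A w‖ ≤ C * ‖w‖) : ‖A‖ ≤ C := by
  rw [Matrix.l2_opNorm_def]
  exact ContinuousLinearMap.opNorm_le_bound _ hC h

theorem actVec_add_left (A B : Matrix m n ℂ) (w : EuclideanSpace ℂ n) :
    actVec (A + B) w = actVec A w + actVec B w := by
  simp [actVec, Matrix.add_mulVec]

theorem actVec_smul_left (c : ℂ) (A : Matrix m n ℂ) (w : EuclideanSpace ℂ n) :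
    actVec (c • A) w = c • actVec A w := by
  simp [actVec, Matrix.smul_mulVec]

theorem actVec_sub_left (A B : Matrix m n ℂ) (w : EuclideanSpace ℂ n) :
    actVec (A - B) w = actVec A w - actVec B w := by
  simp [actVec, Matrix.sub_mulVec]

theorem actVec_neg_left (A : Matrix m n ℂ) (w : EuclideanSpace ℂ n) :
    actVec (-A) w = -actVec A w := by
  simp [actVec, Matrix.neg_mulVec]

theorem actVec_sub_right (A : Matrix m n ℂ) (w w' : EuclideanSpace ℂ n) :
    actVec A (w - w') = actVec A w - actVec A w' := by
  simp [actVec, Matrix.mulVec_sub]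

theorem actVec_mul [Fintype m] (A : Matrix l m ℂ) (B : Matrix m n ℂ) (w : EuclideanSpace ℂ n) :
    actVec (A * B) w = actVec A (actVec B w) := by
  simp [actVec, Matrix.mulVec_mulVec]

theorem actVec_one [DecidableEq n] (w : EuclideanSpace ℂ n) : actVec (1 : Matrix n n ℂ) w = w := by
  simp [actVec]

theorem inner_actVec_mul_conjTranspose [Fintype m] [DecidableEq m] (A : Matrix m n ℂ)
    (x : EuclideanSpace ℂ m) :
    inner ℂ x (actVec (A * Aᴴ) x) = (‖actVec Aᴴ x‖ ^ 2 : ℝ) := by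
  rw [actVec_mul]
  have h := inner_self_eq_norm_sq_to_K (𝕜 := ℂ) (actVec Aᴴ x)
  push_cast
  refine Eq.trans ?_ h
  simp only [actVec, EuclideanSpace.inner_eq_star_dotProduct]
  rw [Matrix.star_mulVec, Matrix.conjTranspose_conjTranspose, dotProduct_comm,
    dotProduct_comm _ (star _ ᵥ* _), Matrix.dotProduct_mulVec]

/-- The action on a fixed vector, as a continuous linear map in the matrix. -/
noncomputable def actVecCLM [Fintype m] [DecidableEq m] [DecidableEq n] (w : EuclideanSpace ℂ n) :
    Matrix m n ℂ →L[ℂ] EuclideanSpace ℂ m :=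
  LinearMap.mkContinuous
    { toFun := fun A => actVec A w
      map_add' := fun A B => actVec_add_left A B w
      map_smul' := fun c A => actVec_smul_left c A w } ‖w‖
    fun A => (norm_actVec_le A w).trans_eq (mul_comm _ _)

end

variable {m₁ m₂ : ℕ}

/-- The first component of a block vector. -/
noncomputable def upperPart (w : EuclideanSpace ℂ (Fin m₁ ⊕ Fin m₂)) : EuclideanSpace ℂ (Fin m₁) :=
  toLp 2 fun i => w (Sum.inl i)

/-- The second component of a block vector. -/
noncomputable def lowerPart (w : EuclideanSpace ℂ (Fin m₁ ⊕ Fin m₂)) : EuclideanSpace ℂ (Fin m₂) :=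
  toLp 2 fun i => w (Sum.inr i)

theorem norm_sq_eq_upperPart_add_lowerPart (w : EuclideanSpace ℂ (Fin m₁ ⊕ Fin m₂)) :
    ‖w‖ ^ 2 = ‖upperPart w‖ ^ 2 + ‖lowerPart w‖ ^ 2 := by
  simp [EuclideanSpace.norm_sq_eq, upperPart, lowerPart]

theorem norm_upperPart_le (w : EuclideanSpace ℂ (Fin m₁ ⊕ Fin m₂)) : ‖upperPart w‖ ≤ ‖w‖ := by
  have h := norm_sq_eq_upperPart_add_lowerPart w
  nlinarith [norm_nonneg w, norm_nonneg (upperPart w), sq_nonneg ‖lowerPart w‖]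

theorem norm_lowerPart_le (w : EuclideanSpace ℂ (Fin m₁ ⊕ Fin m₂)) : ‖lowerPart w‖ ≤ ‖w‖ := by
  have h := norm_sq_eq_upperPart_add_lowerPart w
  nlinarith [norm_nonneg w, norm_nonneg (lowerPart w), sq_nonneg ‖upperPart w‖]

/-- `upperPart` as a continuous linear map. -/
noncomputable def upperPartCLM :
    EuclideanSpace ℂ (Fin m₁ ⊕ Fin m₂) →L[ℂ] EuclideanSpace ℂ (Fin m₁) :=
  LinearMap.mkContinuous
    { toFun := upperPart, map_add' := fun _ _ => rfl, map_smul' := fun _ _ => rfl } 1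
    fun w => (norm_upperPart_le w).trans_eq (one_mul _).symm

/-- `lowerPart` as a continuous linear map. -/
noncomputable def lowerPartCLM :
    EuclideanSpace ℂ (Fin m₁ ⊕ Fin m₂) →L[ℂ] EuclideanSpace ℂ (Fin m₂) :=
  LinearMap.mkContinuous
    { toFun := lowerPart, map_add' := fun _ _ => rfl, map_smul' := fun _ _ => rfl } 1
    fun w => (norm_lowerPart_le w).trans_eq (one_mul _).symm

theorem upperPart_actVec (A : BlockMat m₁ m₂) (w : EuclideanSpace ℂ (Fin m₁ ⊕ Fin m₂)) :
    upperPart (actVec A w) =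
      actVec A.toBlocks₁₁ (upperPart w) + actVec A.toBlocks₁₂ (lowerPart w) := by
  ext i
  simp [upperPart, lowerPart, actVec, Matrix.mulVec, dotProduct, Matrix.toBlocks₁₁,
    Matrix.toBlocks₁₂]

theorem lowerPart_actVec (A : BlockMat m₁ m₂) (w : EuclideanSpace ℂ (Fin m₁ ⊕ Fin m₂)) :
    lowerPart (actVec A w) =
      actVec A.toBlocks₂₁ (upperPart w) + actVec A.toBlocks₂₂ (lowerPart w) := by
  ext i
  simp [upperPart, lowerPart, actVec, Matrix.mulVec, dotProduct, Matrix.toBlocks₂₁,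
    Matrix.toBlocks₂₂]

/-- `A` damps the first component at rate `β`, amplifies the second one at rate `β`, and couples
them with strength at most `μ`. -/
def IsDichotomic (β μ : ℝ) (A : BlockMat m₁ m₂) : Prop :=
  ∀ w : EuclideanSpace ℂ (Fin m₁ ⊕ Fin m₂),
    inner ℝ (upperPart w) (upperPart (actVec A w)) ≤
      -β * ‖upperPart w‖ ^ 2 + μ * (‖upperPart w‖ * ‖lowerPart w‖) ∧
    β * ‖lowerPart w‖ ^ 2 - μ * (‖upperPart w‖ * ‖lowerPart w‖) ≤
      inner ℝ (lowerPart w) (lowerPart (actVec A w))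

theorem isDichotomic_of_blocks {A : BlockMat m₁ m₂} {β μ : ℝ}
    (h₁₁ : ∀ x, inner ℝ x (actVec A.toBlocks₁₁ x) = -β * ‖x‖ ^ 2)
    (h₂₂ : ∀ x, inner ℝ x (actVec A.toBlocks₂₂ x) = β * ‖x‖ ^ 2)
    (h₁₂ : ‖A.toBlocks₁₂‖ ≤ μ) (h₂₁ : ‖A.toBlocks₂₁‖ ≤ μ) : IsDichotomic β μ A := by
  intro w
  rw [upperPart_actVec, lowerPart_actVec, inner_add_right, inner_add_right, h₁₁, h₂₂]
  have h1 : inner ℝ (upperPart w) (actVec A.toBlocks₁₂ (lowerPart w)) ≤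
      μ * (‖upperPart w‖ * ‖lowerPart w‖) :=
    calc _ ≤ ‖upperPart w‖ * ‖actVec A.toBlocks₁₂ (lowerPart w)‖ := real_inner_le_norm _ _
      _ ≤ ‖upperPart w‖ * (μ * ‖lowerPart w‖) := by
        gcongr
        exact (norm_actVec_le _ _).trans (by gcongr)
      _ = _ := by ring
  have h2 : -inner ℝ (lowerPart w) (actVec A.toBlocks₂₁ (upperPart w)) ≤
      μ * (‖upperPart w‖ * ‖lowerPart w‖) :=
    calc _ ≤ ‖lowerPart w‖ * ‖actVec A.toBlocks₂₁ (upperPart w)‖ :=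
          (neg_le_abs _).trans (abs_real_inner_le_norm _ _)
      _ ≤ ‖lowerPart w‖ * (μ * ‖upperPart w‖) := by
        gcongr
        exact (norm_actVec_le _ _).trans (by gcongr)
      _ = _ := by ring
  constructor <;> linarith

theorem real_inner_eq_re_complex_inner {n : Type*} [Fintype n] (x y : EuclideanSpace ℂ n) :
    inner ℝ x y = (inner ℂ x y).re := by
  simp [PiLp.inner_apply, Complex.inner]

theorem inner_smul_self {n : Type*} [Fintype n] (c : ℂ) (x : EuclideanSpace ℂ n) :
    inner ℝ x (c • x) = c.re * ‖x‖ ^ 2 := by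
  rw [real_inner_eq_re_complex_inner, inner_smul_right, inner_self_eq_norm_sq_to_K]
  have h : ((‖x‖ : ℂ) ^ 2) = ((‖x‖ ^ 2 : ℝ) : ℂ) := by push_cast; rfl
  simp [-Complex.ofReal_pow, h]

theorem inner_smul_mul_conjTranspose {m n : Type*} [Fintype m] [DecidableEq m] [Fintype n]
    [DecidableEq n] (c : ℂ) (hc : c.re = 0)
    (A : Matrix m n ℂ) (x : EuclideanSpace ℂ m) : inner ℝ x (c • actVec (A * Aᴴ) x) = 0 := by
  rw [real_inner_eq_re_complex_inner, inner_smul_right, inner_actVec_mul_conjTranspose]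
  rw [Complex.mul_re, Complex.ofReal_im, hc]
  simp

theorem coeffG_eq_fromBlocks (z : ℂ) (v : Matrix (Fin m₁) (Fin m₂) ℂ) :
    coeffG z v = Matrix.fromBlocks ((Complex.I * z) • 1) v (-vᴴ) (-((Complex.I * z) • 1)) := by
  simp [coeffG, signMat, potential, Matrix.fromBlocks_smul, Matrix.fromBlocks_multiply,
    Matrix.fromBlocks_add]

theorem fromBlocks_sub_fromBlocks {l m n o : Type*} (A A' : Matrix n l ℂ) (B B' : Matrix n m ℂ)
    (C C' : Matrix o l ℂ) (D D' : Matrix o m ℂ) :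
    Matrix.fromBlocks A B C D - Matrix.fromBlocks A' B' C' D' =
      Matrix.fromBlocks (A - A') (B - B') (C - C') (D - D') := by
  simp [sub_eq_add_neg, Matrix.fromBlocks_neg, Matrix.fromBlocks_add]

theorem coeffF_eq_fromBlocks (z : ℂ) (v vx : Matrix (Fin m₁) (Fin m₂) ℂ) :
    coeffF z v vx = Matrix.fromBlocks
      ((Complex.I * z ^ 2) • 1 - (Complex.I / 2) • (v * vᴴ)) (z • v - (Complex.I / 2) • vx)
      (-(z • vᴴ) - (Complex.I / 2) • vxᴴ)
      (-((Complex.I * z ^ 2) • 1) + (Complex.I / 2) • (vᴴ * v)) := by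
  have hI : Complex.I * (Complex.I * z) = -z := by
    rw [← mul_assoc, Complex.I_mul_I, neg_one_mul]
  have h2 : Complex.I * 2⁻¹ = Complex.I / 2 := rfl
  simp only [coeffF, signMat, potential, Matrix.fromBlocks_smul, Matrix.fromBlocks_multiply,
    Matrix.fromBlocks_add, sq (Matrix.fromBlocks _ _ _ _), fromBlocks_sub_fromBlocks]
  congr 1 <;> simp [smul_smul, hI, h2, sub_eq_add_neg]

/-- The diagonal blocks are ±iz, with real parts ∓Im z; the coupling is v and -v*. -/
theorem isDichotomic_coeffG {z : ℂ} {v : Matrix (Fin m₁) (Fin m₂) ℂ} {M : ℝ} (hv : ‖v‖ ≤ M) :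
    IsDichotomic z.im M (coeffG z v) := by
  rw [coeffG_eq_fromBlocks]
  refine isDichotomic_of_blocks (fun x => ?_) (fun x => ?_) ?_ ?_
  · rw [Matrix.toBlocks_fromBlocks₁₁, actVec_smul_left, actVec_one, inner_smul_self]
    simp
  · rw [Matrix.toBlocks_fromBlocks₂₂, actVec_neg_left, actVec_smul_left, actVec_one,
      inner_neg_right, inner_smul_self]
    simp
  · simpa using hv
  · simpa [Matrix.l2_opNorm_conjTranspose] using hv

/-- The rate comes from Re(iz²) = -2 Re z Im z. The diagonal terms in vv* and v*v carry the factor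
i/2, so they are skew-Hermitian and drop out of the real inner product. The off-diagonal blocks have
norm at most |z| ‖v‖ + ‖v_x‖/2. -/
theorem isDichotomic_coeffF {z : ℂ} {v vx : Matrix (Fin m₁) (Fin m₂) ℂ} {M C : ℝ}
    (hv : ‖v‖ ≤ M) (hvx : ‖vx‖ ≤ C) :
    IsDichotomic (2 * z.re * z.im) (‖z‖ * M + C / 2) (coeffF z v vx) := by
  have hI : ‖(Complex.I / 2 : ℂ)‖ = 1 / 2 := by simp
  have hre : (Complex.I / 2 : ℂ).re = 0 := by simp
  have hz : (Complex.I * z ^ 2).re = -(2 * z.re * z.im) := by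
    simp [sq, Complex.mul_im]
    ring
  rw [coeffF_eq_fromBlocks]
  refine isDichotomic_of_blocks (fun x => ?_) (fun x => ?_) ?_ ?_
  · rw [Matrix.toBlocks_fromBlocks₁₁, actVec_sub_left, actVec_smul_left, actVec_smul_left,
      actVec_one, inner_sub_right, inner_smul_self, inner_smul_mul_conjTranspose _ hre, hz]
    ring
  · have h := inner_smul_mul_conjTranspose _ hre vᴴ x
    rw [Matrix.conjTranspose_conjTranspose] at h
    rw [Matrix.toBlocks_fromBlocks₂₂, actVec_add_left, actVec_neg_left, actVec_smul_left,
      actVec_smul_left, actVec_one, inner_add_right, inner_neg_right, inner_smul_self, h, hz]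
    ring
  · rw [Matrix.toBlocks_fromBlocks₁₂]
    refine (norm_sub_le _ _).trans ?_
    rw [norm_smul, norm_smul, hI]
    have := mul_le_mul_of_nonneg_left hv (norm_nonneg z)
    linarith
  · rw [Matrix.toBlocks_fromBlocks₂₁]
    refine (norm_sub_le _ _).trans ?_
    rw [norm_neg, norm_smul, norm_smul, hI, Matrix.l2_opNorm_conjTranspose,
      Matrix.l2_opNorm_conjTranspose]
    have := mul_le_mul_of_nonneg_left hv (norm_nonneg z)
    linarith

variable {A Y : ℝ → BlockMat m₁ m₂} {β μ T : ℝ}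

theorem hasDerivWithinAt_upperPart_actVec {s : ℝ}
    (hY : HasDerivWithinAt Y (A s * Y s) (Ici 0) s) (w : EuclideanSpace ℂ (Fin m₁ ⊕ Fin m₂)) :
    HasDerivWithinAt (fun s => upperPart (actVec (Y s) w))
      (upperPart (actVec (A s) (actVec (Y s) w))) (Ici 0) s := by
  rw [← actVec_mul]
  exact (((upperPartCLM.comp (actVecCLM w)).restrictScalars ℝ).hasFDerivAt).comp_hasDerivWithinAt
    s hY

theorem hasDerivWithinAt_lowerPart_actVec {s : ℝ}
    (hY : HasDerivWithinAt Y (A s * Y s) (Ici 0) s) (w : EuclideanSpace ℂ (Fin m₁ ⊕ Fin m₂)) :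
    HasDerivWithinAt (fun s => lowerPart (actVec (Y s) w))
      (lowerPart (actVec (A s) (actVec (Y s) w))) (Ici 0) s := by
  rw [← actVec_mul]
  exact (((lowerPartCLM.comp (actVecCLM w)).restrictScalars ℝ).hasFDerivAt).comp_hasDerivWithinAt
    s hY

/-- The indefinite form `‖w₂‖² - ‖w₁‖²` on block vectors. -/
noncomputable def energy (w : EuclideanSpace ℂ (Fin m₁ ⊕ Fin m₂)) : ℝ :=
  ‖lowerPart w‖ ^ 2 - ‖upperPart w‖ ^ 2

theorem exp_mul_energy_actVec_le (hμ : 0 ≤ μ) (hβ : μ ≤ β)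
    (hY : ∀ s ∈ Icc 0 T, HasDerivWithinAt Y (A s * Y s) (Ici 0) s)
    (hA : ∀ s ∈ Icc 0 T, IsDichotomic β μ (A s)) (w : EuclideanSpace ℂ (Fin m₁ ⊕ Fin m₂))
    {r : ℝ} (hr : r ∈ Icc 0 T) :
    Real.exp (2 * (β - μ) * (T - r)) * energy (actVec (Y r) w) ≤ energy (actVec (Y T) w) :=
  exp_mul_energy_le hμ hβ (fun s hs => hasDerivWithinAt_upperPart_actVec (hY s hs) w)
    (fun s hs => hasDerivWithinAt_lowerPart_actVec (hY s hs) w)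
    (fun s hs => (hA s hs _).1) (fun s hs => (hA s hs _).2) hr

/-- Inside the cone the second component is dominated by the first, so the coupling costs at most μ
of the damping rate β. -/
theorem norm_upperPart_actVec_le (hT : 0 ≤ T) (hμ : 0 ≤ μ)
    (hY : ∀ s ∈ Icc 0 T, HasDerivWithinAt Y (A s * Y s) (Ici 0) s)
    (hA : ∀ s ∈ Icc 0 T, IsDichotomic β μ (A s)) {w : EuclideanSpace ℂ (Fin m₁ ⊕ Fin m₂)}
    (hw : ∀ s ∈ Icc 0 T, energy (actVec (Y s) w) ≤ 0) :
    ‖upperPart (actVec (Y T) w)‖ ≤ Real.exp (-(β - μ) * T) * ‖upperPart (actVec (Y 0) w)‖ := by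
  refine norm_le_exp_mul_of_inner_le (f := fun s => upperPart (actVec (Y s) w)) hT
    (fun s hs => hasDerivWithinAt_upperPart_actVec (hY s hs) w) fun s hs => ?_
  refine (hA s hs _).1.trans ?_
  have h := hw s hs
  rw [energy, sub_nonpos, pow_le_pow_iff_left₀ (norm_nonneg _) (norm_nonneg _) two_ne_zero] at h
  nlinarith [mul_le_mul_of_nonneg_left h (norm_nonneg (upperPart (actVec (Y s) w))),
    mul_le_mul_of_nonneg_left (mul_le_mul_of_nonneg_left h
      (norm_nonneg (upperPart (actVec (Y s) w)))) hμ]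

end BlockVectors

/-! ### Truncated Weyl coefficients and existence of a GW-function -/

section Weyl

open Set WithLp Filter Topology

variable {m₁ m₂ : ℕ}

/-- The block vector `[h; φ h]`. -/
noncomputable def graphVec (φ : Matrix (Fin m₂) (Fin m₁) ℂ) (h : EuclideanSpace ℂ (Fin m₁)) :
    EuclideanSpace ℂ (Fin m₁ ⊕ Fin m₂) :=
  actVec (Matrix.fromRows (1 : Matrix (Fin m₁) (Fin m₁) ℂ) φ) h

theorem upperPart_graphVec (φ : Matrix (Fin m₂) (Fin m₁) ℂ) (h : EuclideanSpace ℂ (Fin m₁)) :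
    upperPart (graphVec φ h) = h := by
  ext i
  simp [upperPart, graphVec, actVec]

theorem lowerPart_graphVec (φ : Matrix (Fin m₂) (Fin m₁) ℂ) (h : EuclideanSpace ℂ (Fin m₁)) :
    lowerPart (graphVec φ h) = actVec φ h := by
  ext i
  simp [lowerPart, graphVec, actVec]

theorem upperPart_sub (w w' : EuclideanSpace ℂ (Fin m₁ ⊕ Fin m₂)) :
    upperPart (w - w') = upperPart w - upperPart w' := rfl

theorem lowerPart_sub (w w' : EuclideanSpace ℂ (Fin m₁ ⊕ Fin m₂)) :
    lowerPart (w - w') = lowerPart w - lowerPart w' := rfl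

theorem upperPart_graphVec_sub (φ φ' : Matrix (Fin m₂) (Fin m₁) ℂ)
    (h : EuclideanSpace ℂ (Fin m₁)) : upperPart (graphVec φ h - graphVec φ' h) = 0 := by
  rw [upperPart_sub, upperPart_graphVec, upperPart_graphVec, sub_self]

theorem lowerPart_graphVec_sub (φ φ' : Matrix (Fin m₂) (Fin m₁) ℂ)
    (h : EuclideanSpace ℂ (Fin m₁)) :
    lowerPart (graphVec φ h - graphVec φ' h) = actVec (φ - φ') h := by
  rw [lowerPart_sub, lowerPart_graphVec, lowerPart_graphVec, actVec_sub_left]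

theorem norm_lowerPart_le_of_energy_nonpos {w : EuclideanSpace ℂ (Fin m₁ ⊕ Fin m₂)}
    (hw : energy w ≤ 0) : ‖lowerPart w‖ ≤ ‖upperPart w‖ := by
  rwa [energy, sub_nonpos, pow_le_pow_iff_left₀ (norm_nonneg _) (norm_nonneg _) two_ne_zero] at hw

theorem norm_le_of_energy_nonpos {w : EuclideanSpace ℂ (Fin m₁ ⊕ Fin m₂)}
    (hw : energy w ≤ 0) : ‖w‖ ≤ 2 * ‖upperPart w‖ := by
  have h := norm_sq_eq_upperPart_add_lowerPart w
  have h' := norm_lowerPart_le_of_energy_nonpos hw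
  refine abs_le_of_sq_le_sq' ?_ (by positivity) |>.2
  nlinarith [norm_nonneg (upperPart w), norm_nonneg (lowerPart w)]

theorem continuous_energy : Continuous (energy (m₁ := m₁) (m₂ := m₂)) :=
  ((lowerPartCLM.continuous.norm).pow 2).sub ((upperPartCLM.continuous.norm).pow 2)

variable {A Y : ℝ → BlockMat m₁ m₂} {β μ T : ℝ}

/-- The initial energy is ‖w₂‖², since w₁ = 0; it grows at rate 2(β - μ), and the final energy is at
most the square of the second component. -/
theorem exp_mul_norm_lowerPart_le (hT : 0 ≤ T) (hμ : 0 ≤ μ) (hβ : μ ≤ β)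
    (hY : IsFundamentalSolution A Y) (hA : ∀ s, 0 ≤ s → IsDichotomic β μ (A s))
    {w : EuclideanSpace ℂ (Fin m₁ ⊕ Fin m₂)} (hw : upperPart w = 0) :
    Real.exp ((β - μ) * T) * ‖lowerPart w‖ ≤ ‖lowerPart (actVec (Y T) w)‖ := by
  have h := exp_mul_energy_actVec_le (A := A) hμ hβ (fun s hs => hY.2 s hs.1)
    (fun s hs => hA s hs.1) w ⟨le_rfl, hT⟩
  rw [hY.1, actVec_one, sub_zero] at h
  refine abs_le_of_sq_le_sq' ?_ (by positivity) |>.2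
  calc (Real.exp ((β - μ) * T) * ‖lowerPart w‖) ^ 2 = Real.exp (2 * (β - μ) * T) * energy w := by
        rw [energy, hw, norm_zero, mul_pow, ← Real.exp_nat_mul]
        push_cast
        ring_nf
    _ ≤ _ := h
    _ ≤ _ := by
      rw [energy]
      linarith [sq_nonneg ‖upperPart (actVec (Y T) w)‖]

theorem exp_mul_norm_le_toBlocks₂₂ (hT : 0 ≤ T) (hμ : 0 ≤ μ) (hβ : μ ≤ β)
    (hY : IsFundamentalSolution A Y) (hA : ∀ s, 0 ≤ s → IsDichotomic β μ (A s))
    (h : EuclideanSpace ℂ (Fin m₂)) :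
    Real.exp ((β - μ) * T) * ‖h‖ ≤ ‖actVec (Y T).toBlocks₂₂ h‖ := by
  set w : EuclideanSpace ℂ (Fin m₁ ⊕ Fin m₂) := toLp 2 (Sum.elim 0 (ofLp h)) with hw
  have h1 : upperPart w = 0 := rfl
  have h2 : lowerPart w = h := rfl
  have h3 := exp_mul_norm_lowerPart_le hT hμ hβ hY hA h1
  rw [lowerPart_actVec, h1, h2] at h3
  simpa [actVec] using h3

theorem isUnit_det_toBlocks₂₂ (hT : 0 ≤ T) (hμ : 0 ≤ μ) (hβ : μ ≤ β)
    (hY : IsFundamentalSolution A Y) (hA : ∀ s, 0 ≤ s → IsDichotomic β μ (A s)) :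
    IsUnit (Y T).toBlocks₂₂.det := by
  rw [← Matrix.isUnit_iff_isUnit_det, ← Matrix.mulVec_injective_iff_isUnit]
  intro x y hxy
  have h := exp_mul_norm_le_toBlocks₂₂ hT hμ hβ hY hA (toLp 2 (x - y))
  have h0 : actVec (Y T).toBlocks₂₂ (toLp 2 (x - y)) = 0 := by
    simp [actVec, Matrix.mulVec_sub, hxy]
  rw [h0, norm_zero] at h
  have h1 : ‖toLp 2 (x - y)‖ ≤ 0 := by
    by_contra! hlt
    exact absurd h (not_le.2 (mul_pos (Real.exp_pos _) hlt))
  have h2 := norm_le_zero_iff.1 h1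
  exact sub_eq_zero.1 (congrArg ofLp h2)

/-- The coefficient `φ` for which the second component of `Y [1; φ]` vanishes. -/
noncomputable def truncatedWeyl (Y : BlockMat m₁ m₂) : Matrix (Fin m₂) (Fin m₁) ℂ :=
  -(Y.toBlocks₂₂⁻¹ * Y.toBlocks₂₁)

theorem lowerPart_actVec_graphVec_truncatedWeyl {Y : BlockMat m₁ m₂}
    (hY : IsUnit Y.toBlocks₂₂.det) (h : EuclideanSpace ℂ (Fin m₁)) :
    lowerPart (actVec Y (graphVec (truncatedWeyl Y) h)) = 0 := by
  rw [lowerPart_actVec, upperPart_graphVec, lowerPart_graphVec, ← actVec_mul, truncatedWeyl,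
    Matrix.mul_neg, Matrix.mul_nonsing_inv_cancel_left _ _ hY, actVec_neg_left, add_neg_cancel]

/-- Positive energy stays positive forwards in time, so nonpositive energy at T forces it at all
earlier times. -/
theorem energy_actVec_nonpos_of_le (hμ : 0 ≤ μ) (hβ : μ ≤ β)
    (hY : IsFundamentalSolution A Y) (hA : ∀ s, 0 ≤ s → IsDichotomic β μ (A s))
    {w : EuclideanSpace ℂ (Fin m₁ ⊕ Fin m₂)} (hw : energy (actVec (Y T) w) ≤ 0) {s : ℝ}
    (hs : s ∈ Icc 0 T) : energy (actVec (Y s) w) ≤ 0 := by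
  have h := exp_mul_energy_actVec_le (A := A) hμ hβ (fun s hs => hY.2 s hs.1)
    (fun s hs => hA s hs.1) w hs
  by_contra! hlt
  exact absurd (h.trans hw) (not_le.2 (mul_pos (Real.exp_pos _) hlt))

theorem energy_truncatedWeyl_nonpos (hμ : 0 ≤ μ) (hβ : μ ≤ β)
    (hY : IsFundamentalSolution A Y) (hA : ∀ s, 0 ≤ s → IsDichotomic β μ (A s)) {s : ℝ}
    (hs : s ∈ Icc 0 T) (h : EuclideanSpace ℂ (Fin m₁)) :
    energy (actVec (Y s) (graphVec (truncatedWeyl (Y T)) h)) ≤ 0 := by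
  refine energy_actVec_nonpos_of_le hμ hβ hY hA ?_ hs
  rw [energy, lowerPart_actVec_graphVec_truncatedWeyl
    (isUnit_det_toBlocks₂₂ (hs.1.trans hs.2) hμ hβ hY hA), norm_zero]
  nlinarith [sq_nonneg ‖upperPart (actVec (Y T) (graphVec (truncatedWeyl (Y T)) h))‖]

theorem norm_upperPart_graphVec_le (hT : 0 ≤ T) (hμ : 0 ≤ μ)
    (hY : IsFundamentalSolution A Y) (hA : ∀ s, 0 ≤ s → IsDichotomic β μ (A s))
    {φ : Matrix (Fin m₂) (Fin m₁) ℂ} {h : EuclideanSpace ℂ (Fin m₁)}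
    (hφ : ∀ s ∈ Icc 0 T, energy (actVec (Y s) (graphVec φ h)) ≤ 0) :
    ‖upperPart (actVec (Y T) (graphVec φ h))‖ ≤ Real.exp (-(β - μ) * T) * ‖h‖ := by
  have := norm_upperPart_actVec_le (A := A) hT hμ (fun s hs => hY.2 s hs.1)
    (fun s hs => hA s hs.1) hφ
  rwa [hY.1, actVec_one, upperPart_graphVec] at this

/-- The vectors [h; φ_T h] and [h; φh] differ by [0; (φ_T - φ)h], which Y(T) expands by e^{(β-μ)T}.
The first has no second component at time T, so the second component of this image is, up to sign,
that of Y(T)[h; φh], which the cone bounds by e^{-(β-μ)T}‖h‖. With φ a later truncation this is a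
Cauchy estimate; with φ the limit, a rate of convergence. -/
theorem norm_truncatedWeyl_sub_le (hμ : 0 ≤ μ) (hβ : μ ≤ β)
    (hY : IsFundamentalSolution A Y) (hA : ∀ s, 0 ≤ s → IsDichotomic β μ (A s)) (hT : 0 ≤ T)
    {φ : Matrix (Fin m₂) (Fin m₁) ℂ}
    (hφ : ∀ s ∈ Icc 0 T, ∀ h, energy (actVec (Y s) (graphVec φ h)) ≤ 0) :
    ‖truncatedWeyl (Y T) - φ‖ ≤ Real.exp (-(2 * (β - μ)) * T) := by
  refine l2_opNorm_le_of_actVec (Real.exp_pos _).le fun h => ?_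
  have h1 := exp_mul_norm_lowerPart_le hT hμ hβ hY hA
    (upperPart_graphVec_sub (truncatedWeyl (Y T)) (φ) h)
  rw [lowerPart_graphVec_sub, actVec_sub_right, lowerPart_sub,
    lowerPart_actVec_graphVec_truncatedWeyl (isUnit_det_toBlocks₂₂ hT hμ hβ hY hA), zero_sub,
    norm_neg] at h1
  have h2 := norm_lowerPart_le_of_energy_nonpos (hφ T ⟨hT, le_rfl⟩ h)
  have h3 := norm_upperPart_graphVec_le hT hμ hY hA fun r hr => hφ r hr h
  calc _ = Real.exp (-(β - μ) * T) * (Real.exp ((β - μ) * T) *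
        ‖actVec (truncatedWeyl (Y T) - φ) h‖) := by
        rw [← mul_assoc, ← Real.exp_add, neg_mul, neg_add_cancel, Real.exp_zero, one_mul]
    _ ≤ Real.exp (-(β - μ) * T) * (Real.exp (-(β - μ) * T) * ‖h‖) := by
      exact mul_le_mul_of_nonneg_left (h1.trans (h2.trans h3)) (Real.exp_pos _).le
    _ = _ := by
      rw [← mul_assoc, ← Real.exp_add]
      ring_nf

/-- Matrix multiplication as a bounded bilinear map. -/
noncomputable def matMulCLM (l m n : ℕ) : Matrix (Fin l) (Fin m) ℂ →L[ℂ]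
    Matrix (Fin m) (Fin n) ℂ →L[ℂ] Matrix (Fin l) (Fin n) ℂ :=
  LinearMap.mkContinuous₂
    (LinearMap.mk₂ ℂ (fun A B => A * B) Matrix.add_mul (fun c A B => Matrix.smul_mul c A B)
      Matrix.mul_add (fun c A B => Matrix.mul_smul A c B)) 1
    fun A B => by simpa using Matrix.l2_opNorm_mul A B

theorem differentiableAt_bilinear_apply {E F G H : Type*} [NormedAddCommGroup E] [NormedSpace ℂ E]
    [NormedAddCommGroup F] [NormedSpace ℂ F] [NormedAddCommGroup G] [NormedSpace ℂ G]
    [NormedAddCommGroup H] [NormedSpace ℂ H] (B : F →L[ℂ] G →L[ℂ] H) {f : E → F} {g : E → G}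
    {z : E} (hf : DifferentiableAt ℂ f z) (hg : DifferentiableAt ℂ g z) :
    DifferentiableAt ℂ (fun z => B (f z) (g z)) z := by
  fun_prop

/-- The lower left block as a continuous linear map. -/
noncomputable def toBlocks₂₁CLM : BlockMat m₁ m₂ →L[ℂ] Matrix (Fin m₂) (Fin m₁) ℂ :=
  LinearMap.toContinuousLinearMap
    { toFun := Matrix.toBlocks₂₁, map_add' := fun _ _ => rfl, map_smul' := fun _ _ => rfl }

/-- The lower right block as a continuous linear map. -/
noncomputable def toBlocks₂₂CLM : BlockMat m₁ m₂ →L[ℂ] Matrix (Fin m₂) (Fin m₂) ℂ :=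
  LinearMap.toContinuousLinearMap
    { toFun := Matrix.toBlocks₂₂, map_add' := fun _ _ => rfl, map_smul' := fun _ _ => rfl }

theorem differentiableAt_truncatedWeyl {f : ℂ → BlockMat m₁ m₂} {z : ℂ}
    (hf : DifferentiableAt ℂ f z) (hz : IsUnit (f z).toBlocks₂₂.det) :
    DifferentiableAt ℂ (fun z => truncatedWeyl (f z)) z := by
  have h1 : DifferentiableAt ℂ (fun z => (f z).toBlocks₂₁) z :=
    (toBlocks₂₁CLM (m₁ := m₁) (m₂ := m₂)).differentiableAt.comp z hf
  have h2 : DifferentiableAt ℂ (fun z => (f z).toBlocks₂₂) z :=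
    (toBlocks₂₂CLM (m₁ := m₁) (m₂ := m₂)).differentiableAt.comp z hf
  have h3 : DifferentiableAt ℂ (fun z => ((f z).toBlocks₂₂)⁻¹) z := by
    simp only [Matrix.nonsing_inv_eq_ringInverse]
    exact DifferentiableAt.comp (g := Ring.inverse) z
      (differentiableAt_inverse ((Matrix.isUnit_iff_isUnit_det _).2 hz)) h2
  exact (differentiableAt_bilinear_apply (matMulCLM m₂ m₂ m₁) h3 h1).neg

theorem continuousOn_coeffG {v : ℝ → Matrix (Fin m₁) (Fin m₂) ℂ} {s : Set ℝ}
    (hv : ContinuousOn v s) (z : ℂ) : ContinuousOn (fun x => coeffG z (v x)) s := by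
  have : Continuous fun v : Matrix (Fin m₁) (Fin m₂) ℂ => coeffG z v := by
    unfold coeffG potential
    fun_prop
  exact this.comp_continuousOn hv

theorem differentiable_fundamentalSolution {v : ℝ → Matrix (Fin m₁) (Fin m₂) ℂ}
    (hv : ContinuousOn v (Ici 0)) {u : ℂ → ℝ → BlockMat m₁ m₂}
    (hu : ∀ z, IsFundamentalSolution (fun x => coeffG z (v x)) (u z)) {x : ℝ} (hx : 0 ≤ x) :
    Differentiable ℂ fun z => u z x := by
  refine differentiable_linear_ode (a := fun _ => Complex.I • signMat m₁ m₂)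
    (b := fun x => signMat m₁ m₂ * potential (v x)) continuousOn_const ?_ (fun z => (hu z).1)
    (fun z s hs => ?_) hx
  · have h := continuousOn_coeffG hv 0
    simpa [coeffG] using h
  · have h := (hu z).2 s hs
    simpa only [coeffG, mul_comm Complex.I z, mul_smul] using h

/-- The truncations at integer times are holomorphic and converge locally uniformly. Nonpositive
energy at a fixed x holds for all truncations at later times, and it is a closed condition, so the
limit inherits it. -/
theorem exists_weylFunction {v : ℝ → Matrix (Fin m₁) (Fin m₂) ℂ} {M : ℝ} (hM : 0 ≤ M)
    (hv : ContinuousOn v (Ici 0)) (hvM : ∀ x, 0 ≤ x → ‖v x‖ ≤ M) {u : ℂ → ℝ → BlockMat m₁ m₂}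
    (hu : ∀ z, IsFundamentalSolution (fun x => coeffG z (v x)) (u z)) :
    ∃ φ : ℂ → Matrix (Fin m₂) (Fin m₁) ℂ, DifferentiableOn ℂ φ (upperHalf M) ∧
      ∀ z ∈ upperHalf M, ∀ x, 0 ≤ x → ∀ h, energy (actVec (u z x) (graphVec (φ z) h)) ≤ 0 := by
  have hA : ∀ z, ∀ s, 0 ≤ s → IsDichotomic z.im M (coeffG z (v s)) := fun z s hs =>
    isDichotomic_coeffG (hvM s hs)
  have hle : ∀ z ∈ upperHalf M, ∀ k n : ℕ, k ≤ n →
      ‖truncatedWeyl (u z k) - truncatedWeyl (u z n)‖ ≤ Real.exp (-(2 * (z.im - M)) * k) :=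
    fun z hz k n hkn => norm_truncatedWeyl_sub_le hM (le_of_lt hz) (hu z) (hA z)
      (Nat.cast_nonneg k) fun s hs h => energy_truncatedWeyl_nonpos hM (le_of_lt hz) (hu z) (hA z)
        ⟨hs.1, hs.2.trans (Nat.cast_le.2 hkn)⟩ h
  have hexp : ∀ c : ℝ, 0 < c → Tendsto (fun k : ℕ => Real.exp (-c * k)) atTop (𝓝 0) := fun c hc =>
    Real.tendsto_exp_neg_atTop_nhds_zero.comp
      (tendsto_natCast_atTop_atTop.const_mul_atTop hc) |>.congr fun k => by simp
  -- Outside the half-plane the value is immaterial and is set to 0.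
  have hlim : ∀ z, ∃ φ, z ∈ upperHalf M →
      Tendsto (fun n : ℕ => truncatedWeyl (u z n)) atTop (𝓝 φ) := by
    intro z
    by_cases hz : z ∈ upperHalf M
    · have hc : CauchySeq fun n : ℕ => truncatedWeyl (u z n) :=
        cauchySeq_of_le_tendsto_0' _ (fun k n hkn => by
          rw [dist_eq_norm]; exact hle z hz k n hkn)
          (hexp _ (mul_pos two_pos (sub_pos.2 hz)))
      obtain ⟨φ, hφ⟩ := cauchySeq_tendsto_of_complete hc
      exact ⟨φ, fun _ => hφ⟩
    · exact ⟨0, fun h => absurd h hz⟩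
  choose φ hφ using hlim
  have hbd : ∀ z ∈ upperHalf M, ∀ k : ℕ,
      ‖truncatedWeyl (u z k) - φ z‖ ≤ Real.exp (-(2 * (z.im - M)) * k) := fun z hz k =>
    le_of_tendsto ((tendsto_const_nhds.sub (hφ z hz)).norm)
      (eventually_atTop.2 ⟨k, fun n hn => hle z hz k n hn⟩)
  have hopen : IsOpen (upperHalf M) := isOpen_lt continuous_const Complex.continuous_im
  refine ⟨φ, ?_, fun z hz x hx h => ?_⟩
  · refine TendstoLocallyUniformlyOn.differentiableOn (F := fun (n : ℕ) z => truncatedWeyl (u z n))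
      (φ := atTop) ?_ (Eventually.of_forall fun n z hz => ?_) hopen
    · rw [Metric.tendstoLocallyUniformlyOn_iff]
      intro ε hε z hz
      have hδ : 0 < z.im - M := sub_pos.2 hz
      -- On this neighbourhood the rate 2(Im w - M) stays above Im z - M, which makes the
      -- convergence uniform there.
      refine ⟨{w | M + (z.im - M) / 2 < w.im}, mem_nhdsWithin_of_mem_nhds
        ((isOpen_lt continuous_const Complex.continuous_im).mem_nhds ?_), ?_⟩
      · change M + (z.im - M) / 2 < z.im
        linarith
      · filter_upwards [(hexp _ hδ).eventually_lt_const hε] with n hn w hw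
        change M + (z.im - M) / 2 < w.im at hw
        rw [dist_comm, dist_eq_norm]
        refine (hbd w (by change M < w.im; linarith) n).trans_lt (lt_of_le_of_lt ?_ hn)
        gcongr
        linarith
    · exact (differentiableAt_truncatedWeyl
        ((differentiable_fundamentalSolution hv hu (Nat.cast_nonneg n)) z)
        (isUnit_det_toBlocks₂₂ (Nat.cast_nonneg n) hM (le_of_lt hz) (hu z)
          (hA z))).differentiableWithinAt
  · have hg : Tendsto (fun n : ℕ => graphVec (truncatedWeyl (u z n)) h) atTop
        (𝓝 (graphVec (φ z) h)) := by
      rw [tendsto_iff_norm_sub_tendsto_zero]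
      have h0 : Tendsto (fun n : ℕ => ‖truncatedWeyl (u z n) - φ z‖ * ‖h‖) atTop (𝓝 0) := by
        simpa using ((tendsto_iff_norm_sub_tendsto_zero.1 (hφ z hz)).mul_const ‖h‖)
      refine squeeze_zero (fun _ => norm_nonneg _) (fun n => ?_) h0
      refine le_trans (le_of_eq ?_) (norm_actVec_le _ h)
      rw [← lowerPart_graphVec_sub, ← sq_eq_sq₀ (norm_nonneg _) (norm_nonneg _),
        norm_sq_eq_upperPart_add_lowerPart, upperPart_graphVec_sub]
      simp
    have hcont : Continuous fun w => energy (actVec (u z x) w) := by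
      refine continuous_energy.comp ?_
      have : LipschitzWith ‖u z x‖₊ fun w => actVec (u z x) w :=
        LipschitzWith.of_dist_le_mul fun w w' => by
          rw [dist_eq_norm, dist_eq_norm, ← actVec_sub_right]
          exact norm_actVec_le _ _
      exact this.continuous
    obtain ⟨N, hN⟩ := exists_nat_ge x
    exact le_of_tendsto ((hcont.tendsto _).comp hg) (eventually_atTop.2 ⟨N, fun n hn =>
      energy_truncatedWeyl_nonpos hM (le_of_lt hz) (hu z) (hA z)
        ⟨hx, hN.trans (Nat.cast_le.2 hn)⟩ h⟩)

theorem norm_actVec_graphVec_le (hT : 0 ≤ T) (hμ : 0 ≤ μ)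
    (hY : IsFundamentalSolution A Y) (hA : ∀ s, 0 ≤ s → IsDichotomic β μ (A s))
    {φ : Matrix (Fin m₂) (Fin m₁) ℂ} {h : EuclideanSpace ℂ (Fin m₁)}
    (hφ : ∀ s, 0 ≤ s → energy (actVec (Y s) (graphVec φ h)) ≤ 0) :
    ‖actVec (Y T) (graphVec φ h)‖ ≤ 2 * (Real.exp (-(β - μ) * T) * ‖h‖) :=
  (norm_le_of_energy_nonpos (hφ T hT)).trans (mul_le_mul_of_nonneg_left
    (norm_upperPart_graphVec_le hT hμ hY hA fun s hs => hφ s hs.1) zero_le_two)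

theorem norm_exp_neg_I_mul (z : ℂ) (x : ℝ) :
    ‖Complex.exp (-(Complex.I * z * (x : ℂ)))‖ = Real.exp (z.im * x) := by
  rw [Complex.norm_exp]
  simp

/-- The cone gives the bound 2e^{-(Im z - M)x}; the modulus e^{x Im z} of the exponential factor
cancels the dependence on z and leaves 2e^{Mx}. -/
theorem isGWFunctionOn_of_energy_nonpos {v : ℝ → Matrix (Fin m₁) (Fin m₂) ℂ} {M : ℝ}
    (hM : 0 ≤ M) (hvM : ∀ x, 0 ≤ x → ‖v x‖ ≤ M) {u : ℂ → ℝ → BlockMat m₁ m₂}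
    (hu : ∀ z, IsFundamentalSolution (fun x => coeffG z (v x)) (u z))
    {φ : ℂ → Matrix (Fin m₂) (Fin m₁) ℂ} (hφ : DifferentiableOn ℂ φ (upperHalf M))
    (hφu : ∀ z ∈ upperHalf M, ∀ x, 0 ≤ x → ∀ h,
      energy (actVec (u z x) (graphVec (φ z) h)) ≤ 0) : IsGWFunctionOn M v φ := by
  refine ⟨hφ, u, hu, fun l => ⟨2 * Real.exp (M * l), fun x hx z hz => ?_⟩⟩
  rw [norm_smul, norm_exp_neg_I_mul]
  have h1 : ‖u z x * Matrix.fromRows (1 : Matrix (Fin m₁) (Fin m₁) ℂ) (φ z)‖ ≤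
      2 * Real.exp (-(z.im - M) * x) :=
    l2_opNorm_le_of_actVec (by positivity) fun h => by
      rw [actVec_mul, mul_assoc]
      exact norm_actVec_graphVec_le hx.1 hM (hu z)
        (fun s hs => isDichotomic_coeffG (hvM s hs)) fun s hs => hφu z hz s hs h
  calc _ ≤ Real.exp (z.im * x) * (2 * Real.exp (-(z.im - M) * x)) := by gcongr
    _ = 2 * Real.exp (M * x) := by
      rw [mul_left_comm, ← Real.exp_add]
      ring_nf
    _ ≤ 2 * Real.exp (M * l) := by
      gcongr
      exact hx.2

end Weyl

/-! ### Uniqueness of the GW-function by Phragmén–Lindelöf -/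

section Uniqueness

open Set Filter Topology

theorem eq_zero_of_norm_le_exp_neg_mul_im {E : Type*} [NormedAddCommGroup E] [NormedSpace ℂ E]
    {f : ℂ → E} {N : ℝ} (hf : DifferentiableOn ℂ f (upperHalf N))
    (hdecay : ∀ n : ℕ, ∃ C, ∀ z ∈ upperHalf N, ‖f z‖ ≤ C * Real.exp (-n * z.im)) {z : ℂ}
    (hz : z ∈ upperHalf N) : f z = 0 := by
  -- A rotation carries the half-plane Im ≥ Im z onto the closed right half-plane; it lies inside
  -- the open domain of `f`, and z corresponds to a boundary point.
  set g : ℂ → E := fun ζ => f (Complex.I * (ζ + z.im)) with hg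
  have him : ∀ ζ : ℂ, (Complex.I * (ζ + z.im)).im = ζ.re + z.im := fun ζ => by simp
  have hmem : ∀ ζ : ℂ, 0 ≤ ζ.re → Complex.I * (ζ + z.im) ∈ upperHalf N := fun ζ hζ => by
    change N < (Complex.I * (ζ + z.im)).im
    rw [him]
    have : N < z.im := hz
    linarith
  have hEq : EqOn g 0 {ζ | 0 ≤ ζ.re} := by
    refine PhragmenLindelof.eq_zero_on_right_half_plane_of_superexponential_decay ?_
      ⟨0, two_pos, 0, ?_⟩ (fun n => ?_) ?_
    · refine DifferentiableOn.diffContOnCl ?_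
      rw [Complex.closure_setOfPred_lt_re]
      exact hf.comp (by fun_prop : Differentiable ℂ fun ζ : ℂ =>
        Complex.I * (ζ + z.im)).differentiableOn fun ζ hζ => hmem ζ hζ
    · obtain ⟨C, hC⟩ := hdecay 0
      refine Asymptotics.IsBigO.of_bound C ?_
      refine eventually_inf_principal.2 (Eventually.of_forall fun ζ hζ => ?_)
      have := hC _ (hmem ζ (le_of_lt hζ))
      simpa using this
    -- The spare exponential turns a bound on e^{nx}‖g(x)‖ into convergence to 0.
    · obtain ⟨C, hC⟩ := hdecay (n + 1)
      have h0 : Tendsto (fun x : ℝ => C * Real.exp (-x)) atTop (𝓝 0) := by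
        simpa using Real.tendsto_exp_neg_atTop_nhds_zero.const_mul C
      have hC0 : 0 ≤ C := by
        have := (norm_nonneg _).trans (hC z hz)
        exact nonneg_of_mul_nonneg_left this (Real.exp_pos _)
      have hC' : Tendsto (fun x : ℝ => Real.exp (-((n + 1 : ℕ) * z.im)) * (C * Real.exp (-x)))
          atTop (𝓝 0) := by simpa using h0.const_mul (Real.exp (-((n + 1 : ℕ) * z.im)))
      refine squeeze_zero' (Eventually.of_forall fun x => by positivity) ?_ hC'
      filter_upwards [eventually_ge_atTop 0] with x hx
      have h := hC _ (hmem x (by simpa using hx))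
      rw [him, Complex.ofReal_re] at h
      calc Real.exp x ^ n * ‖g x‖
          ≤ Real.exp x ^ n * (C * Real.exp (-((n + 1 : ℕ) : ℝ) * (x + z.im))) := by gcongr
        _ = C * (Real.exp (n * x) * Real.exp (-((n + 1 : ℕ) : ℝ) * (x + z.im))) := by
          rw [← Real.exp_nat_mul]; ring
        _ = C * (Real.exp (-((n + 1 : ℕ) * z.im)) * Real.exp (-x)) := by
          rw [← Real.exp_add, ← Real.exp_add]; push_cast; ring_nf
        _ = _ := by ring
    · obtain ⟨C, hC⟩ := hdecay 0
      refine ⟨C, fun x => ?_⟩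
      have := hC _ (hmem (x * Complex.I) (by simp))
      simpa using this
  have h := hEq (x := -Complex.I * z - z.im) (by simp)
  simpa [hg, ← mul_assoc] using h

variable {m₁ m₂ : ℕ}

theorem fundamentalSolution_unique {A Y Y' : ℝ → BlockMat m₁ m₂} (hA : ContinuousOn A (Ici 0))
    (hY : IsFundamentalSolution A Y) (hY' : IsFundamentalSolution A Y') {x : ℝ} (hx : 0 ≤ x) :
    Y x = Y' x :=
  linear_ode_unique hA (fun s hs => hY.2 s hs.1) (fun s hs => hY'.2 s hs.1)
    (hY.1.trans hY'.1.symm) ⟨hx, le_rfl⟩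

/-- A GW-function comes with its own fundamental solutions; uniqueness for the equation allows two
GW-functions to be compared along the same `u`. -/
theorem exists_bound_actVec_graphVec {K : ℝ} {v : ℝ → Matrix (Fin m₁) (Fin m₂) ℂ}
    (hv : ContinuousOn v (Ici 0)) {φ : ℂ → Matrix (Fin m₂) (Fin m₁) ℂ}
    (hφ : IsGWFunctionOn K v φ) {u : ℂ → ℝ → BlockMat m₁ m₂}
    (hu : ∀ z, IsFundamentalSolution (fun x => coeffG z (v x)) (u z)) {x : ℝ} (hx : 0 ≤ x) :
    ∃ C, ∀ z ∈ upperHalf K, ∀ h,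
      ‖actVec (u z x) (graphVec (φ z) h)‖ ≤ Real.exp (-z.im * x) * (C * ‖h‖) := by
  obtain ⟨-, u', hu', hC⟩ := hφ
  obtain ⟨C, hC⟩ := hC x
  refine ⟨C, fun z hz h => ?_⟩
  have h1 := hC x ⟨hx, le_rfl⟩ z hz
  rw [fundamentalSolution_unique (continuousOn_coeffG hv z) (hu' z) (hu z) hx, norm_smul,
    norm_exp_neg_I_mul] at h1
  have h2 : ‖actVec (u z x) (graphVec (φ z) h)‖ ≤
      ‖u z x * Matrix.fromRows (1 : Matrix (Fin m₁) (Fin m₁) ℂ) (φ z)‖ * ‖h‖ := by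
    rw [graphVec, ← actVec_mul]
    exact norm_actVec_le _ _
  calc _ ≤ ‖u z x * Matrix.fromRows (1 : Matrix (Fin m₁) (Fin m₁) ℂ) (φ z)‖ * ‖h‖ := h2
    _ = Real.exp (-z.im * x) * ((Real.exp (z.im * x) *
        ‖u z x * Matrix.fromRows (1 : Matrix (Fin m₁) (Fin m₁) ℂ) (φ z)‖) * ‖h‖) := by
      rw [mul_assoc (Real.exp (z.im * x)), ← mul_assoc, ← Real.exp_add]
      simp
    _ ≤ _ := by gcongr

/-- The vector [0; (φ - φ')h] is expanded by at least e^{(Im w - M)x}, while both GW-bounds make its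
image O(e^{-x Im w}). At x = n the difference is therefore O(e^{Mn - 2n Im w}), which is more than
the decay needed for each n. -/
theorem gwFunction_unique {K K' M : ℝ} (hM : 0 ≤ M) {v : ℝ → Matrix (Fin m₁) (Fin m₂) ℂ}
    (hv : ContinuousOn v (Ici 0)) (hvM : ∀ x, 0 ≤ x → ‖v x‖ ≤ M)
    {φ φ' : ℂ → Matrix (Fin m₂) (Fin m₁) ℂ} (hφ : IsGWFunctionOn K v φ)
    (hφ' : IsGWFunctionOn K' v φ') {z : ℂ} (hzK : K < z.im) (hzK' : K' < z.im) (hzM : M < z.im) :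
    φ z = φ' z := by
  have hφu := hφ
  obtain ⟨hd, u, hu, -⟩ := hφ
  set N := max M (max K K') with hN
  have hsub : upperHalf N ⊆ upperHalf K := fun w hw =>
    lt_of_le_of_lt (b := N) ((le_max_left K K').trans (le_max_right _ _)) hw
  have hsub' : upperHalf N ⊆ upperHalf K' := fun w hw =>
    lt_of_le_of_lt (b := N) ((le_max_right K K').trans (le_max_right _ _)) hw
  refine sub_eq_zero.1 (eq_zero_of_norm_le_exp_neg_mul_im (f := fun w => φ w - φ' w) (N := N)
    ((hd.mono hsub).sub (hφ'.1.mono hsub')) (fun n => ?_)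
    (max_lt hzM (max_lt hzK hzK')))
  obtain ⟨C, hC⟩ := exists_bound_actVec_graphVec hv hφu hu (Nat.cast_nonneg n)
  obtain ⟨C', hC'⟩ := exists_bound_actVec_graphVec hv hφ' hu (Nat.cast_nonneg n)
  refine ⟨Real.exp (M * n) * (max C 0 + max C' 0), fun w hw => ?_⟩
  have hMw : M < w.im := lt_of_le_of_lt (b := N) (le_max_left _ _) hw
  refine l2_opNorm_le_of_actVec (by positivity) fun h => ?_
  have h1 := exp_mul_norm_lowerPart_le (Nat.cast_nonneg n) hM hMw.le (hu w)
    (fun s hs => isDichotomic_coeffG (hvM s hs)) (upperPart_graphVec_sub (φ w) (φ' w) h)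
  rw [lowerPart_graphVec_sub, actVec_sub_right] at h1
  have h2 : Real.exp ((w.im - M) * n) * ‖actVec (φ w - φ' w) h‖ ≤
      Real.exp (-w.im * n) * ((max C 0 + max C' 0) * ‖h‖) :=
    calc _ ≤ _ := h1.trans ((norm_lowerPart_le _).trans (norm_sub_le _ _))
      _ ≤ Real.exp (-w.im * n) * (C * ‖h‖) + Real.exp (-w.im * n) * (C' * ‖h‖) :=
        add_le_add (hC w (hsub hw) h) (hC' w (hsub' hw) h)
      _ ≤ Real.exp (-w.im * n) * (max C 0 * ‖h‖) + Real.exp (-w.im * n) * (max C' 0 * ‖h‖) := by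
        gcongr
        · exact le_max_left _ _
        · exact le_max_left _ _
      _ = _ := by ring
  calc ‖actVec (φ w - φ' w) h‖
      = Real.exp (-((w.im - M) * n)) * (Real.exp ((w.im - M) * n) *
        ‖actVec (φ w - φ' w) h‖) := by
        rw [← mul_assoc, ← Real.exp_add, neg_add_cancel, Real.exp_zero, one_mul]
    _ ≤ Real.exp (-((w.im - M) * n)) *
        (Real.exp (-w.im * n) * ((max C 0 + max C' 0) * ‖h‖)) :=
      mul_le_mul_of_nonneg_left h2 (Real.exp_pos _).le
    _ = Real.exp (-((w.im - M) * n) + -w.im * n) * ((max C 0 + max C' 0) * ‖h‖) := by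
      rw [Real.exp_add]; ring
    _ ≤ Real.exp (M * n + -n * w.im) * ((max C 0 + max C' 0) * ‖h‖) := by
      refine mul_le_mul_of_nonneg_right (Real.exp_le_exp.2 ?_) (by positivity)
      nlinarith [mul_nonneg (hM.trans hMw.le) (Nat.cast_nonneg (α := ℝ) n)]
    _ = _ := by rw [Real.exp_add]; ring

end Uniqueness

/-! ### Compatibility of the two flows from zero curvature -/

section ZeroCurvature

open Set

variable {E : Type*} [NormedAddCommGroup E] [NormedSpace ℂ E] [CompleteSpace E]

theorem hasDerivWithinAt_clm_apply {F G : Type*} [NormedAddCommGroup F] [NormedSpace ℂ F]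
    [NormedAddCommGroup G] [NormedSpace ℂ G] (L : F →L[ℂ] G) {f : ℝ → F} {f' : F} {s : Set ℝ}
    {t : ℝ} (hf : HasDerivWithinAt f f' s t) : HasDerivWithinAt (fun t => L (f t)) (L f') s t :=
  ((L.restrictScalars ℝ).hasFDerivAt).comp_hasDerivWithinAt t hf

/-- A curve in `C([0, X], E)` that is differentiable pointwise, with a continuous derivative, is
differentiable for the supremum norm. -/
theorem hasDerivWithinAt_of_pointwise {X : ℝ} {g g' : ℝ → C(Icc 0 X, E)}
    (hg' : ContinuousOn g' (Ici 0))
    (hg : ∀ x, ∀ t, 0 ≤ t → HasDerivWithinAt (fun t => g t x) (g' t x) (Ici 0) t)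
    {t : ℝ} (ht : 0 ≤ t) : HasDerivWithinAt g (g' t) (Ici 0) t := by
  refine hasDerivWithinAt_of_eq_integral (c := g 0) (T := t + 1) hg' (fun s hs => ?_)
    ⟨ht, lt_add_one t⟩
  ext1 x
  have hx : ContinuousOn (fun t => g' t x) (Ici 0) :=
    (ContinuousMap.evalCLM ℂ x).continuous.comp_continuousOn hg'
  have hint : IntervalIntegrable g' MeasureTheory.volume 0 s :=
    (hg'.mono (by rw [uIcc_of_le hs.1]; exact Icc_subset_Ici_self)).intervalIntegrable
  have h := eq_integral_of_hasDerivWithinAt hx (hg x) hs.1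
  rw [ContinuousMap.add_apply, h]
  congr 1
  exact ((ContinuousMap.evalCLM ℂ x).intervalIntegral_comp_comm hint)

variable {A : Type*} [NormedRing A] [NormedAlgebra ℂ A] [CompleteSpace A]

/-- The Leibniz rule in integrated form, with the order of the factors kept. -/
theorem const_add_primitiveCLM_mul {X : ℝ} (hX : 0 ≤ X) {f f' g g' : C(Icc 0 X, A)} {a b : A}
    (hf : f = ContinuousMap.const _ a + primitiveCLM hX f')
    (hg : g = ContinuousMap.const _ b + primitiveCLM hX g') :
    f * g = ContinuousMap.const _ (a * b) + primitiveCLM hX (f' * g + f * g') := by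
  have hderiv : ∀ (f f' : C(Icc 0 X, A)) (a : A), f = ContinuousMap.const _ a + primitiveCLM hX f' →
      ∀ s : ℝ, HasDerivAt (fun s => a + ∫ r in (0 : ℝ)..s, IccExtend hX f' r)
        (IccExtend hX f' s) s := fun f f' a _ s =>
    (intervalIntegral.integral_hasDerivAt_right
      (f'.continuous.Icc_extend'.intervalIntegrable _ _)
      (f'.continuous.Icc_extend'.stronglyMeasurableAtFilter _ _)
      f'.continuous.Icc_extend'.continuousAt).const_add a
  have hval : ∀ (f f' : C(Icc 0 X, A)) (a : A), f = ContinuousMap.const _ a + primitiveCLM hX f' →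
      ∀ s (hs : s ∈ Icc 0 X), a + ∫ r in (0 : ℝ)..s, IccExtend hX f' r = f ⟨s, hs⟩ :=
    fun f f' a hf s hs => by
      conv_rhs => rw [hf]
      rfl
  ext1 x
  have hprod := fun s => (hderiv f f' a hf s).mul (hderiv g g' b hg s)
  have h := intervalIntegral.integral_eq_sub_of_hasDerivAt (a := 0) (b := x)
    (fun s _ => hprod s) (by
      refine Continuous.intervalIntegrable ?_ _ _
      have h1 := continuous_iff_continuousAt.2 fun s => (hderiv f f' a hf s).continuousAt
      have h2 := continuous_iff_continuousAt.2 fun s => (hderiv g g' b hg s).continuousAt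
      exact (f'.continuous.Icc_extend'.mul h2).add (h1.mul g'.continuous.Icc_extend'))
  have h2 : primitiveCLM hX (f' * g + f * g') x = ∫ s in (0 : ℝ)..x,
      (IccExtend hX f' s * (b + ∫ r in (0 : ℝ)..s, IccExtend hX g' r) +
        (a + ∫ r in (0 : ℝ)..s, IccExtend hX f' r) * IccExtend hX g' s) :=
    primitiveCLM_apply_of_eqOn hX _ (fun s => by
      rw [hval f f' a hf s s.2, hval g g' b hg s s.2, IccExtend_val, IccExtend_val]; rfl) x
  rw [ContinuousMap.add_apply, h2, h]
  simp only [Pi.mul_apply, hval f f' a hf x x.2, hval g g' b hg x x.2, ContinuousMap.mul_apply,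
    intervalIntegral.integral_same, add_zero, ContinuousMap.const_apply]
  abel

/-- If `∂ₜ g + g f = ∂ₓ f + f g`, the flows `∂ₜ Z = f Z` and `∂ₓ Z = g Z` are compatible: a solution of
the first which satisfies the second at `t = 0`, and whose value at `x = 0` is `R`, satisfies the
second for all `t`. -/
theorem eq_const_add_primitiveCLM_of_zeroCurvature {X : ℝ} (hX : 0 ≤ X)
    {f f' g g' Z : ℝ → C(Icc 0 X, A)} {a R : ℝ → A}
    (hf : ContinuousOn f (Ici 0)) (hf' : ContinuousOn f' (Ici 0))
    (hfx : ∀ t, 0 ≤ t → f t = ContinuousMap.const _ (a t) + primitiveCLM hX (f' t))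
    (hgt : ∀ t, 0 ≤ t → HasDerivWithinAt g (g' t) (Ici 0) t)
    (hfg : ∀ t, 0 ≤ t → g' t + g t * f t = f' t + f t * g t)
    (hZ : ∀ t, 0 ≤ t → HasDerivWithinAt Z (f t * Z t) (Ici 0) t)
    (hR : ∀ t, 0 ≤ t → HasDerivWithinAt R (a t * R t) (Ici 0) t)
    (h0 : Z 0 = ContinuousMap.const _ (R 0) + primitiveCLM hX (g 0 * Z 0)) {t : ℝ} (ht : 0 ≤ t) :
    Z t = ContinuousMap.const _ (R t) + primitiveCLM hX (g t * Z t) := by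
  obtain ⟨K, hK⟩ := exists_bound_Icc hf t
  obtain ⟨K', hK'⟩ := exists_bound_Icc hf' t
  set H : ℝ → C(Icc 0 X, A) := fun t => ContinuousMap.const _ (R t) + primitiveCLM hX (g t * Z t)
    with hH
  let cst : A →L[ℂ] C(Icc 0 X, A) :=
    LinearMap.mkContinuous
      { toFun := ContinuousMap.const _, map_add' := fun _ _ => rfl, map_smul' := fun _ _ => rfl } 1
      fun a => by
        rw [one_mul]
        exact (ContinuousMap.norm_le _ (norm_nonneg _)).2 fun _ => le_rfl
  -- The difference Z - H then satisfies a homogeneous linear equation with value 0 at t = 0, and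
  -- Gronwall's inequality kills it. Only Z_t, g_t and f_x enter, so no mixed derivative of Z is
  -- needed.
  have hHt : ∀ s, 0 ≤ s → HasDerivWithinAt H
      (f s * H s + primitiveCLM hX (f' s * (Z s - H s))) (Ici 0) s := by
    intro s hs
    have h1 : HasDerivWithinAt (fun t => cst (R t)) (cst (a s * R s)) (Ici 0) s :=
      hasDerivWithinAt_clm_apply cst (hR s hs)
    have h2 : HasDerivWithinAt (fun t => primitiveCLM hX (g t * Z t))
        (primitiveCLM hX (g' s * Z s + g s * (f s * Z s))) (Ici 0) s :=
      hasDerivWithinAt_clm_apply (primitiveCLM hX) ((hgt s hs).mul (hZ s hs))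
    -- Zero curvature trades g_t + gf for f_x + fg. Replacing Z by H in the f_x term makes the
    -- bracket the x-derivative of fH, because H has x-derivative gZ.
    have h3 : g' s * Z s + g s * (f s * Z s) =
        (f' s * H s + f s * (g s * Z s)) + f' s * (Z s - H s) := by
      rw [← mul_assoc, ← add_mul, hfg s hs]
      rw [add_mul, mul_sub, mul_assoc]
      abel
    have h4 := const_add_primitiveCLM_mul hX (hfx s hs) (g := H s) (b := R s) rfl
    rw [h4]
    rw [h3, map_add] at h2
    have h5 := h1.add h2
    rw [← add_assoc] at h5
    exact h5
  have hE := norm_le_exp_mul_of_norm_deriv_le (f := fun s => Z s - H s)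
    (K := K + ‖primitiveCLM (E := A) hX‖ * K') ht
    (fun s hs => (hZ s hs.1).sub (hHt s hs.1)) (fun s hs => by
      have h1 : f s * Z s - (f s * H s + primitiveCLM hX (f' s * (Z s - H s))) =
          f s * (Z s - H s) - primitiveCLM hX (f' s * (Z s - H s)) := by
        rw [mul_sub (f s)]; abel
      rw [h1]
      refine (norm_sub_le _ _).trans ?_
      rw [add_mul, mul_assoc]
      refine add_le_add ((norm_mul_le _ _).trans (by gcongr; exact hK s hs))
        ((ContinuousLinearMap.le_opNorm _ _).trans ?_)
      gcongr
      exact (norm_mul_le _ _).trans (by gcongr; exact hK' s hs))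
  have h00 : Z 0 - H 0 = 0 := sub_eq_zero.2 h0
  rw [h00, norm_zero, mul_zero] at hE
  exact sub_eq_zero.1 (norm_le_zero_iff.1 hE)

end ZeroCurvature

/-! ### Regularity of the solution on the closed quarter-plane -/

section QuarterPlane

open Set

theorem hasDerivWithinAt_fst_of_contDiffOn {E : Type*} [NormedAddCommGroup E] [NormedSpace ℝ E]
    {v : ℝ → ℝ → E} (hv : ContDiffOn ℝ 1 (Function.uncurry v) (Ici 0 ×ˢ Ici 0)) {x t : ℝ}
    (hx : 0 ≤ x) (ht : 0 ≤ t) : HasDerivWithinAt (fun ξ => v ξ t)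
      (fderivWithin ℝ (Function.uncurry v) (Ici 0 ×ˢ Ici 0) (x, t) (1, 0)) (Ici 0) x :=
  ((hv.differentiableOn one_ne_zero (x, t) ⟨hx, ht⟩).hasFDerivWithinAt).comp_hasDerivWithinAt
    (f := fun ξ => (ξ, t)) x ((hasDerivWithinAt_id x _).prodMk (hasDerivWithinAt_const x _ t))
    fun _ h => ⟨h, ht⟩

theorem hasDerivWithinAt_snd_of_contDiffOn {E : Type*} [NormedAddCommGroup E] [NormedSpace ℝ E]
    {v : ℝ → ℝ → E} (hv : ContDiffOn ℝ 1 (Function.uncurry v) (Ici 0 ×ˢ Ici 0)) {x t : ℝ}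
    (hx : 0 ≤ x) (ht : 0 ≤ t) : HasDerivWithinAt (fun τ => v x τ)
      (fderivWithin ℝ (Function.uncurry v) (Ici 0 ×ˢ Ici 0) (x, t) (0, 1)) (Ici 0) t :=
  ((hv.differentiableOn one_ne_zero (x, t) ⟨hx, ht⟩).hasFDerivWithinAt).comp_hasDerivWithinAt
    (f := fun τ => (x, τ)) t ((hasDerivWithinAt_const t _ x).prodMk (hasDerivWithinAt_id t _))
    fun _ h => ⟨hx, h⟩

theorem continuousOn_fderivWithin_apply_of_contDiffOn {E : Type*} [NormedAddCommGroup E]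
    [NormedSpace ℝ E] {v : ℝ → ℝ → E}
    (hv : ContDiffOn ℝ 1 (Function.uncurry v) (Ici 0 ×ˢ Ici 0)) (e : ℝ × ℝ) :
    ContinuousOn (fun p => fderivWithin ℝ (Function.uncurry v) (Ici 0 ×ˢ Ici 0) p e)
      (Ici 0 ×ˢ Ici 0) :=
  (hv.continuousOn_fderivWithin ((uniqueDiffOn_Ici 0).prod (uniqueDiffOn_Ici 0)) le_rfl).clm_apply
    continuousOn_const

variable {m₁ m₂ : ℕ} {v : ℝ → ℝ → Matrix (Fin m₁) (Fin m₂) ℂ}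

theorem IsFocusingNLSSolution.hasDerivWithinAt_x (hv : IsFocusingNLSSolution v) {x t : ℝ}
    (hx : 0 ≤ x) (ht : 0 ≤ t) : HasDerivWithinAt (fun ξ => v ξ t) (partialX v x t) (Ici 0) x :=
  (hasDerivWithinAt_fst_of_contDiffOn hv.contDiffOn hx ht).differentiableWithinAt.hasDerivWithinAt

theorem IsFocusingNLSSolution.hasDerivWithinAt_t (hv : IsFocusingNLSSolution v) {x t : ℝ}
    (hx : 0 ≤ x) (ht : 0 ≤ t) : HasDerivWithinAt (fun τ => v x τ) (partialT v x t) (Ici 0) t :=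
  (hasDerivWithinAt_snd_of_contDiffOn hv.contDiffOn hx ht).differentiableWithinAt.hasDerivWithinAt

theorem IsFocusingNLSSolution.hasDerivWithinAt_xx (hv : IsFocusingNLSSolution v) {x t : ℝ}
    (hx : 0 ≤ x) (ht : 0 ≤ t) : HasDerivWithinAt (fun ξ => partialX v ξ t)
      (partialX (partialX v) x t) (Ici 0) x :=
  (hv.differentiable_partialX x t hx ht).hasDerivWithinAt

theorem IsFocusingNLSSolution.continuousOn (hv : IsFocusingNLSSolution v) :
    ContinuousOn (Function.uncurry v) (Ici 0 ×ˢ Ici 0) := hv.contDiffOn.continuousOn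

theorem IsFocusingNLSSolution.continuousOn_partialX (hv : IsFocusingNLSSolution v) :
    ContinuousOn (Function.uncurry (partialX v)) (Ici 0 ×ˢ Ici 0) :=
  (continuousOn_fderivWithin_apply_of_contDiffOn hv.contDiffOn (1, 0)).congr fun _ hp =>
    (hasDerivWithinAt_fst_of_contDiffOn hv.contDiffOn hp.1 hp.2).derivWithin
      (uniqueDiffOn_Ici 0 _ hp.1)

theorem IsFocusingNLSSolution.continuousOn_partialT (hv : IsFocusingNLSSolution v) :
    ContinuousOn (Function.uncurry (partialT v)) (Ici 0 ×ˢ Ici 0) :=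
  (continuousOn_fderivWithin_apply_of_contDiffOn hv.contDiffOn (0, 1)).congr fun _ hp =>
    (hasDerivWithinAt_snd_of_contDiffOn hv.contDiffOn hp.1 hp.2).derivWithin
      (uniqueDiffOn_Ici 0 _ hp.2)

theorem IsFocusingNLSSolution.partialX_partialX_eq (hv : IsFocusingNLSSolution v) {x t : ℝ}
    (hx : 0 ≤ x) (ht : 0 ≤ t) : partialX (partialX v) x t =
      (2 * Complex.I) • partialT v x t - (2 : ℂ) • (v x t * (v x t)ᴴ * v x t) := by
  have h := congrArg (fun A => (-Complex.I) • A) (hv.equation x t hx ht)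
  have hI : -Complex.I * (Complex.I * 2) = 2 := by
    rw [← mul_assoc, neg_mul, Complex.I_mul_I, neg_neg, one_mul]
  have hI' : -Complex.I * Complex.I = 1 := by rw [neg_mul, Complex.I_mul_I, neg_neg]
  simp only [smul_zero, smul_add, smul_smul, hI, hI', one_smul] at h
  rw [eq_sub_iff_add_eq, ← sub_eq_zero, ← h]
  module

/-- Only the existence of v_xx is assumed; its joint continuity comes from the equation, which
expresses it through v_t and v. -/
theorem IsFocusingNLSSolution.continuousOn_partialX_partialX (hv : IsFocusingNLSSolution v) :
    ContinuousOn (Function.uncurry (partialX (partialX v))) (Ici 0 ×ˢ Ici 0) := by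
  have hc : Continuous fun p : Matrix (Fin m₁) (Fin m₂) ℂ × Matrix (Fin m₁) (Fin m₂) ℂ =>
      (2 * Complex.I) • p.1 - (2 : ℂ) • (p.2 * p.2ᴴ * p.2) := by fun_prop
  exact (hc.comp_continuousOn (hv.continuousOn_partialT.prodMk hv.continuousOn)).congr fun p hp =>
    hv.partialX_partialX_eq hp.1 hp.2

/-- The curve `t ↦ p(·, t)` in `C([0, X], B)`, frozen for `t ≤ 0`. -/
def sliceCurve {B : Type*} [TopologicalSpace B] (X : ℝ) (p : ℝ → ℝ → B)
    (hp : ContinuousOn (Function.uncurry p) (Ici 0 ×ˢ Ici 0)) (t : ℝ) : C(Icc 0 X, B) :=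
  ⟨fun x => p x (max t 0), hp.comp_continuous (f := fun x : Icc 0 X => ((x : ℝ), max t 0))
    (by fun_prop) fun x => ⟨x.2.1, mem_Ici.2 (le_max_right _ _)⟩⟩

theorem sliceCurve_apply {B : Type*} [TopologicalSpace B] {X : ℝ} {p : ℝ → ℝ → B}
    (hp : ContinuousOn (Function.uncurry p) (Ici 0 ×ˢ Ici 0)) {t : ℝ} (ht : 0 ≤ t) (x : Icc 0 X) :
    sliceCurve X p hp t x = p x t := by
  change p x (max t 0) = _
  rw [max_eq_left ht]

theorem continuous_sliceCurve {B : Type*} [TopologicalSpace B] {X : ℝ} {p : ℝ → ℝ → B}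
    (hp : ContinuousOn (Function.uncurry p) (Ici 0 ×ˢ Ici 0)) : Continuous (sliceCurve X p hp) :=
  ContinuousMap.continuous_of_continuous_uncurry _
    (hp.comp_continuous (f := fun q : ℝ × Icc 0 X => ((q.2 : ℝ), max q.1 0)) (by fun_prop)
      fun q => ⟨q.2.2.1, mem_Ici.2 (le_max_right _ _)⟩)

theorem continuousOn_left_slice {B : Type*} [TopologicalSpace B] {p : ℝ → ℝ → B}
    (hp : ContinuousOn (Function.uncurry p) (Ici 0 ×ˢ Ici 0)) {t : ℝ} (ht : 0 ≤ t) :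
    ContinuousOn (fun x => p x t) (Ici 0) :=
  hp.comp (f := fun x => (x, t)) (by fun_prop) fun _ hx => ⟨hx, ht⟩

theorem continuousOn_right_slice {B : Type*} [TopologicalSpace B] {p : ℝ → ℝ → B}
    (hp : ContinuousOn (Function.uncurry p) (Ici 0 ×ˢ Ici 0)) {x : ℝ} (hx : 0 ≤ x) :
    ContinuousOn (fun t => p x t) (Ici 0) :=
  hp.comp (f := fun t => (x, t)) (by fun_prop) fun _ ht => ⟨hx, ht⟩

end QuarterPlane

/-! ### The Lax pair of the NLS equation -/

section LaxPair

open Set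

variable {m₁ m₂ : ℕ}

/-- `potential` as a real continuous linear map. -/
noncomputable def potentialCLM : Matrix (Fin m₁) (Fin m₂) ℂ →L[ℝ] BlockMat m₁ m₂ :=
  LinearMap.toContinuousLinearMap
    { toFun := potential
      map_add' := fun A B => by simp [potential, Matrix.fromBlocks_add]
      map_smul' := fun c A => by simp [potential, Matrix.fromBlocks_smul] }

/-- The `x`-derivative of `coeffF` in terms of `v`, `v_x` and `v_xx`. -/
noncomputable def coeffFDeriv (z : ℂ) (v vx vxx : Matrix (Fin m₁) (Fin m₂) ℂ) : BlockMat m₁ m₂ :=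
  Complex.I • (-((Complex.I * z) • (signMat m₁ m₂ * potential vx)) - (1 / 2 : ℂ) • (potential vxx +
    signMat m₁ m₂ * (potential vx * potential v + potential v * potential vx)))

theorem signMat_mul_self : signMat m₁ m₂ * signMat m₁ m₂ = 1 := by
  simp [signMat, Matrix.fromBlocks_multiply]

theorem potential_mul_signMat (v : Matrix (Fin m₁) (Fin m₂) ℂ) :
    potential v * signMat m₁ m₂ = -(signMat m₁ m₂ * potential v) := by
  simp [signMat, potential, Matrix.fromBlocks_multiply, Matrix.fromBlocks_neg]

/-- Moving every j to the left with jP = -Pj and jP_x = -P_x j makes all terms containing z cancel;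
what remains is `hPt`, the NLS equation for the potential. -/
theorem lax_commutator {R : Type*} [Ring R] [Algebra ℂ R] {j P Px Pt Pxx : R} (z : ℂ)
    (hj : j * j = 1) (hP : P * j = -(j * P)) (hPx : Px * j = -(j * Px))
    (hPt : j * Pt = -((Complex.I / 2) • (Pxx + (2 : ℂ) • (P * P * P)))) :
    j * Pt + ((Complex.I * z) • j + j * P) * (Complex.I • (z ^ 2 • j - (Complex.I * z) • (j * P)
      - (1 / 2 : ℂ) • (Px + j * P ^ 2))) =
    Complex.I • (-((Complex.I * z) • (j * Px)) - (1 / 2 : ℂ) • (Pxx + j * (Px * P + P * Px))) +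
    (Complex.I • (z ^ 2 • j - (Complex.I * z) • (j * P) - (1 / 2 : ℂ) • (Px + j * P ^ 2))) *
      ((Complex.I * z) • j + j * P) := by
  have hj' : ∀ a, j * (j * a) = a := fun a => by rw [← mul_assoc, hj, one_mul]
  have hP' : ∀ a, P * (j * a) = -(j * (P * a)) := fun a => by
    rw [← mul_assoc, hP, neg_mul, mul_assoc]
  have hPx' : ∀ a, Px * (j * a) = -(j * (Px * a)) := fun a => by
    rw [← mul_assoc, hPx, neg_mul, mul_assoc]
  rw [hPt]
  simp only [sq P, mul_add, add_mul, mul_sub, sub_mul, smul_mul_assoc, mul_smul_comm, mul_assoc,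
    hj, hj', hP, hP', hPx, hPx', mul_neg, neg_neg, smul_neg]
  match_scalars <;> ring_nf
  simp only [Complex.I_pow_three]
  ring

theorem zeroCurvature {v vx vt vxx : Matrix (Fin m₁) (Fin m₂) ℂ} (z : ℂ)
    (h : vxx = (2 * Complex.I) • vt - (2 : ℂ) • (v * vᴴ * v)) :
    signMat m₁ m₂ * potential vt + coeffG z v * coeffF z v vx =
      coeffFDeriv z v vx vxx + coeffF z v vx * coeffG z v := by
  refine lax_commutator z signMat_mul_self (potential_mul_signMat v) (potential_mul_signMat vx) ?_
  have hI : Complex.I / 2 * (2 * Complex.I) = -1 := by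
    rw [div_mul_eq_mul_div, mul_left_comm, Complex.I_mul_I]
    norm_num
  subst h
  simp [signMat, potential, Matrix.fromBlocks_multiply, Matrix.fromBlocks_add,
    Matrix.fromBlocks_smul, Matrix.fromBlocks_neg, smul_smul, hI, Matrix.mul_assoc]

theorem continuous_coeffF (z : ℂ) :
    Continuous fun p : Matrix (Fin m₁) (Fin m₂) ℂ × Matrix (Fin m₁) (Fin m₂) ℂ =>
      coeffF z p.1 p.2 := by
  unfold coeffF potential
  fun_prop

theorem continuous_coeffFDeriv (z : ℂ) :
    Continuous fun p : Matrix (Fin m₁) (Fin m₂) ℂ × Matrix (Fin m₁) (Fin m₂) ℂ ×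
      Matrix (Fin m₁) (Fin m₂) ℂ => coeffFDeriv z p.1 p.2.1 p.2.2 := by
  unfold coeffFDeriv potential
  fun_prop

theorem continuous_coeffG (z : ℂ) :
    Continuous fun v : Matrix (Fin m₁) (Fin m₂) ℂ => coeffG z v := by
  unfold coeffG potential
  fun_prop

theorem exists_bound_coeffF (z : ℂ) (M C : ℝ) :
    ∃ B, ∀ v vx : Matrix (Fin m₁) (Fin m₂) ℂ, ‖v‖ ≤ M → ‖vx‖ ≤ C → ‖coeffF z v vx‖ ≤ B := by
  have : ProperSpace (Matrix (Fin m₁) (Fin m₂) ℂ) := FiniteDimensional.proper ℂ _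
  obtain ⟨B, hB⟩ := ((isCompact_closedBall (0 : Matrix (Fin m₁) (Fin m₂) ℂ) M).prod
    (isCompact_closedBall (0 : Matrix (Fin m₁) (Fin m₂) ℂ) C)).exists_bound_of_continuousOn
    (continuous_coeffF z).continuousOn
  exact ⟨B, fun v vx hv hvx => hB (v, vx) ⟨by simpa using hv, by simpa using hvx⟩⟩

theorem hasDerivWithinAt_coeffG {z : ℂ} {v : ℝ → Matrix (Fin m₁) (Fin m₂) ℂ}
    {v' : Matrix (Fin m₁) (Fin m₂) ℂ} {s : Set ℝ} {t : ℝ} (hv : HasDerivWithinAt v v' s t) :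
    HasDerivWithinAt (fun t => coeffG z (v t)) (signMat m₁ m₂ * potential v') s t := by
  have h : HasDerivWithinAt (fun t => potential (v t)) (potential v') s t :=
    (potentialCLM (m₁ := m₁) (m₂ := m₂)).hasFDerivAt.comp_hasDerivWithinAt t hv
  exact (h.const_mul (signMat m₁ m₂)).const_add _

theorem hasDerivWithinAt_coeffF {z : ℂ} {v vx : ℝ → Matrix (Fin m₁) (Fin m₂) ℂ}
    {vxx : Matrix (Fin m₁) (Fin m₂) ℂ} {s : Set ℝ} {x : ℝ} (hv : HasDerivWithinAt v (vx x) s x)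
    (hvx : HasDerivWithinAt vx vxx s x) :
    HasDerivWithinAt (fun x => coeffF z (v x) (vx x)) (coeffFDeriv z (v x) (vx x) vxx) s x := by
  have h : HasDerivWithinAt (fun t => potential (v t)) (potential (vx x)) s x :=
    (potentialCLM (m₁ := m₁) (m₂ := m₂)).hasFDerivAt.comp_hasDerivWithinAt x hv
  have h' : HasDerivWithinAt (fun t => potential (vx t)) (potential vxx) s x :=
    (potentialCLM (m₁ := m₁) (m₂ := m₂)).hasFDerivAt.comp_hasDerivWithinAt x hvx
  have hsq : HasDerivWithinAt (fun t => potential (v t) ^ 2)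
      (potential (vx x) * potential (v x) + potential (v x) * potential (vx x)) s x := by
    simp only [sq]
    exact h.mul h
  have h1 := (((h.const_mul (signMat m₁ m₂)).const_smul (Complex.I * z)).const_sub
    (z ^ 2 • signMat m₁ m₂)).sub
    ((h'.add (hsq.const_mul (signMat m₁ m₂))).const_smul (1 / 2 : ℂ))
  exact h1.const_smul Complex.I

end LaxPair

/-! ### Transport of the GW-function along the boundary x = 0 -/

section Evolution

open Set Filter Topology

variable {m₁ m₂ : ℕ} {v : ℝ → ℝ → Matrix (Fin m₁) (Fin m₂) ℂ}

/-- The identity `u(X, T) R(0, T) = R(X, T) u(X, 0)` for a zero curvature pair: the flow in `x` at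
time `T` started from `R(T)` and the flow in `t` at `X` started from `u(X)` meet at `(X, T)`. -/
theorem exists_compatible_flows {A : Type*} [NormedRing A] [NormedAlgebra ℂ A] [CompleteSpace A]
    {f f' g g' : ℝ → ℝ → A}
    (hcF : ContinuousOn (Function.uncurry f) (Ici 0 ×ˢ Ici 0))
    (hcF' : ContinuousOn (Function.uncurry f') (Ici 0 ×ˢ Ici 0))
    (hcG : ContinuousOn (Function.uncurry g) (Ici 0 ×ˢ Ici 0))
    (hcG' : ContinuousOn (Function.uncurry g') (Ici 0 ×ˢ Ici 0))
    (hf : ∀ x t, 0 ≤ x → 0 ≤ t → HasDerivWithinAt (fun x => f x t) (f' x t) (Ici 0) x)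
    (hg : ∀ x t, 0 ≤ x → 0 ≤ t → HasDerivWithinAt (fun t => g x t) (g' x t) (Ici 0) t)
    (hzc : ∀ x t, 0 ≤ x → 0 ≤ t → g' x t + g x t * f x t = f' x t + f x t * g x t)
    {u R : ℝ → A} (hu : ∀ x, 0 ≤ x → HasDerivWithinAt u (g x 0 * u x) (Ici 0) x)
    (hR : ∀ t, 0 ≤ t → HasDerivWithinAt R (f 0 t * R t) (Ici 0) t) (huR : u 0 = R 0) {X T : ℝ}
    (hX : 0 ≤ X) (hT : 0 ≤ T) : ∃ W S : ℝ → A, W 0 = R T ∧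
      (∀ x ∈ Icc 0 X, HasDerivWithinAt W (g x T * W x) (Ici 0) x) ∧ S 0 = u X ∧
      (∀ t, 0 ≤ t → HasDerivWithinAt S (f X t * S t) (Ici 0) t) ∧ W X = S T := by
  have huc : ContinuousOn u (Ici 0) := fun s hs => (hu s hs).continuousWithinAt
  -- The t-flows for all x in [0, X] form a single linear equation in the Banach algebra C([0, X],
  -- A), with initial value u.
  obtain ⟨Z, hZ0, hZ⟩ := exists_linear_ode (continuous_sliceCurve (X := X) hcF).continuousOn
    (restrictIcc X u huc)
  have hfx : ∀ t, 0 ≤ t → sliceCurve X _ hcF t =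
      ContinuousMap.const _ (f 0 t) + primitiveCLM hX (sliceCurve X _ hcF' t) := by
    intro t ht
    ext1 x
    have h1 := primitiveCLM_apply_of_eqOn hX (sliceCurve X _ hcF' t)
      (g := fun s => f' s t) (fun s => sliceCurve_apply hcF' ht s) x
    have h2 := eq_integral_of_hasDerivWithinAt (continuousOn_left_slice hcF' ht)
      (fun s hs => hf s t hs ht) x.2.1
    rw [sliceCurve_apply hcF ht, ContinuousMap.add_apply, h1]
    exact h2
  have hgt : ∀ t, 0 ≤ t → HasDerivWithinAt (sliceCurve X _ hcG) (sliceCurve X _ hcG' t)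
      (Ici 0) t := by
    intro t ht
    refine hasDerivWithinAt_of_pointwise (continuous_sliceCurve hcG').continuousOn
      (fun x t ht => ?_) ht
    rw [sliceCurve_apply hcG' ht]
    exact (hg x t x.2.1 ht).congr
      (fun s hs => sliceCurve_apply hcG hs x) (sliceCurve_apply hcG ht x)
  have hfg : ∀ t, 0 ≤ t → sliceCurve X _ hcG' t + sliceCurve X _ hcG t * sliceCurve X _ hcF t =
      sliceCurve X _ hcF' t + sliceCurve X _ hcF t * sliceCurve X _ hcG t := by
    intro t ht
    ext1 x
    simp only [ContinuousMap.add_apply, ContinuousMap.mul_apply, sliceCurve_apply _ ht]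
    exact hzc x t x.2.1 ht
  have h0 : Z 0 = ContinuousMap.const _ (R 0) + primitiveCLM hX (sliceCurve X _ hcG 0 * Z 0) := by
    rw [hZ0]
    ext1 x
    have h1 := primitiveCLM_apply_of_eqOn hX (sliceCurve X _ hcG 0 * restrictIcc X u huc)
      (g := fun s => g s 0 * u s)
      (fun s => by rw [ContinuousMap.mul_apply, sliceCurve_apply hcG le_rfl]; rfl) x
    have h2 := eq_integral_of_hasDerivWithinAt
      ((continuousOn_left_slice hcG le_rfl).mul huc) hu x.2.1
    rw [ContinuousMap.add_apply, h1, ← huR]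
    exact h2
  have hmain := eq_const_add_primitiveCLM_of_zeroCurvature hX
    (continuous_sliceCurve hcF).continuousOn (continuous_sliceCurve hcF').continuousOn
    hfx hgt hfg hZ hR h0 hT
  set ζ := IccExtend hX (Z T)
  have hζ : Continuous ζ := (Z T).continuous.Icc_extend'
  -- The curve Z(T) is replaced by the integral it equals on [0, X], which also has the right
  -- derivative within [0, ∞) at the endpoint X.
  set W : ℝ → A := fun s => R T + ∫ r in (0 : ℝ)..s, g r T * ζ r with hW
  have hWZ : ∀ s (hs : s ∈ Icc 0 X), W s = Z T ⟨s, hs⟩ := by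
    intro s hs
    have h1 := primitiveCLM_apply_of_eqOn hX (sliceCurve X _ hcG T * Z T)
      (g := fun s => g s T * ζ s)
      (fun s => by rw [ContinuousMap.mul_apply, sliceCurve_apply hcG hT]; simp [ζ]) ⟨s, hs⟩
    conv_rhs => rw [hmain]
    rw [ContinuousMap.add_apply, h1]
    rfl
  refine ⟨W, fun t => Z t ⟨X, hX, le_rfl⟩, by simp [hW], fun x hx => ?_, ?_, fun t ht => ?_,
    hWZ X ⟨hX, le_rfl⟩⟩
  · have h1 := hasDerivWithinAt_of_eq_integral (f := W) (c := R T) (T := X + 1)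
      ((continuousOn_left_slice hcG hT).mul hζ.continuousOn) (fun s _ => rfl)
      ⟨hx.1, hx.2.trans_lt (lt_add_one X)⟩
    rw [hWZ x hx]
    rwa [Pi.mul_apply, show ζ x = Z T ⟨x, hx⟩ from IccExtend_of_mem hX (Z T) hx] at h1
  · change Z 0 ⟨X, hX, le_rfl⟩ = u X
    rw [hZ0]
    rfl
  · have h1 := hasDerivWithinAt_clm_apply
      (ContinuousMap.evalCLM ℂ (⟨X, hX, le_rfl⟩ : Icc 0 X)) (hZ t ht)
    simp only [ContinuousMap.evalCLM_apply, ContinuousMap.mul_apply, sliceCurve_apply _ ht] at h1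
    exact h1

theorem continuousOn_uncurry_comp {B C : Type*} [TopologicalSpace B] [TopologicalSpace C]
    {φ : B → C} (hφ : Continuous φ) {p : ℝ → ℝ → B} {s : Set (ℝ × ℝ)}
    (hp : ContinuousOn (Function.uncurry p) s) :
    ContinuousOn (Function.uncurry fun x t => φ (p x t)) s :=
  hφ.comp_continuousOn hp

theorem continuousOn_uncurry_prodMk {B C : Type*} [TopologicalSpace B] [TopologicalSpace C]
    {p : ℝ → ℝ → B} {q : ℝ → ℝ → C} {s : Set (ℝ × ℝ)}
    (hp : ContinuousOn (Function.uncurry p) s) (hq : ContinuousOn (Function.uncurry q) s) :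
    ContinuousOn (Function.uncurry fun x t => (p x t, q x t)) s :=
  hp.prodMk hq

theorem IsFocusingNLSSolution.continuousOn_coeffF (hv : IsFocusingNLSSolution v) (z : ℂ) :
    ContinuousOn (Function.uncurry fun x t => coeffF z (v x t) (partialX v x t))
      (Ici 0 ×ˢ Ici 0) :=
  continuousOn_uncurry_comp (continuous_coeffF z) (p := fun x t => (v x t, partialX v x t))
    (continuousOn_uncurry_prodMk hv.continuousOn hv.continuousOn_partialX)

theorem IsFocusingNLSSolution.continuousOn_coeffFDeriv (hv : IsFocusingNLSSolution v) (z : ℂ) :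
    ContinuousOn (Function.uncurry fun x t => coeffFDeriv z (v x t) (partialX v x t)
      (partialX (partialX v) x t)) (Ici 0 ×ˢ Ici 0) :=
  continuousOn_uncurry_comp (continuous_coeffFDeriv z)
    (p := fun x t => (v x t, partialX v x t, partialX (partialX v) x t))
    (continuousOn_uncurry_prodMk hv.continuousOn
      (continuousOn_uncurry_prodMk hv.continuousOn_partialX hv.continuousOn_partialX_partialX))

theorem IsFocusingNLSSolution.continuousOn_coeffG (hv : IsFocusingNLSSolution v) (z : ℂ) :
    ContinuousOn (Function.uncurry fun x t => coeffG z (v x t)) (Ici 0 ×ˢ Ici 0) :=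
  continuousOn_uncurry_comp (continuous_coeffG z) hv.continuousOn

theorem continuous_signMat_mul_potential :
    Continuous fun v : Matrix (Fin m₁) (Fin m₂) ℂ => signMat m₁ m₂ * potential v := by
  unfold potential
  fun_prop

theorem IsFocusingNLSSolution.exists_compatible_flows (hv : IsFocusingNLSSolution v) {z : ℂ}
    {u R : ℝ → BlockMat m₁ m₂} (hu : IsFundamentalSolution (fun x => coeffG z (v x 0)) u)
    (hR : IsFundamentalSolution (fun t => coeffF z (v 0 t) (partialX v 0 t)) R) {X T : ℝ}
    (hX : 0 ≤ X) (hT : 0 ≤ T) : ∃ W S : ℝ → BlockMat m₁ m₂,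
      W 0 = R T ∧
      (∀ x ∈ Icc 0 X, HasDerivWithinAt W (coeffG z (v x T) * W x) (Ici 0) x) ∧
      S 0 = u X ∧
      (∀ t, 0 ≤ t → HasDerivWithinAt S (coeffF z (v X t) (partialX v X t) * S t) (Ici 0) t) ∧
      W X = S T :=
  _root_.exists_compatible_flows (hv.continuousOn_coeffF z) (hv.continuousOn_coeffFDeriv z)
    (hv.continuousOn_coeffG z)
    (continuousOn_uncurry_comp continuous_signMat_mul_potential hv.continuousOn_partialT)
    (fun _ _ hx ht => hasDerivWithinAt_coeffF (hv.hasDerivWithinAt_x hx ht)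
      (hv.hasDerivWithinAt_xx hx ht))
    (fun _ _ hx ht => hasDerivWithinAt_coeffG (hv.hasDerivWithinAt_t hx ht))
    (fun _ _ hx ht => zeroCurvature z (hv.partialX_partialX_eq hx ht))
    hu.2 hR.2 (hu.1.trans hR.1.symm) hX hT

theorem norm_actVec_le_exp_mul {A Y : ℝ → BlockMat m₁ m₂} {B T : ℝ} (hT : 0 ≤ T)
    (hY : ∀ t, 0 ≤ t → HasDerivWithinAt Y (A t * Y t) (Ici 0) t)
    (hA : ∀ t ∈ Icc 0 T, ‖A t‖ ≤ B) (w : EuclideanSpace ℂ (Fin m₁ ⊕ Fin m₂)) :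
    ‖actVec (Y T) w‖ ≤ Real.exp (B * T) * ‖actVec (Y 0) w‖ := by
  refine norm_le_exp_mul_of_norm_deriv_le (f := fun t => actVec (Y t) w)
    (f' := fun t => actVec (A t) (actVec (Y t) w)) hT (fun t ht => ?_) fun t ht => ?_
  · rw [← actVec_mul]
    exact ((actVecCLM w).restrictScalars ℝ).hasFDerivAt.comp_hasDerivWithinAt t (hY t ht.1)
  · exact (norm_actVec_le _ _).trans (by gcongr; exact hA t ht)

theorem energy_le_norm_sq (w : EuclideanSpace ℂ (Fin m₁ ⊕ Fin m₂)) : energy w ≤ ‖w‖ ^ 2 := by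
  rw [energy, norm_sq_eq_upperPart_add_lowerPart]
  linarith [sq_nonneg ‖upperPart w‖]

/-- This is where the NLS equation meets the Weyl property. Positive energy of R(T)w would persist
along the x-flow at time T up to every X. The matrix reached there is also the t-flow at X started
from u(X), of size at most e^{BT}‖u(X)w‖ on w, with B independent of X because v and v_x are bounded
on the strip. This tends to 0. -/
theorem IsFocusingNLSSolution.energy_actVec_nonpos (hv : IsFocusingNLSSolution v) {M : ℝ}
    (hM : 0 ≤ M) (hbound : ∀ x t, 0 ≤ x → 0 ≤ t → ‖v x t‖ ≤ M)
    (hstrip : ∀ c : ℝ, 0 < c → ∃ C : ℝ, ∀ x t, 0 ≤ x → 0 ≤ t → t < c → ‖partialX v x t‖ ≤ C)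
    {z : ℂ} (hz : M < z.im) {u R : ℝ → BlockMat m₁ m₂}
    (hu : IsFundamentalSolution (fun x => coeffG z (v x 0)) u)
    (hR : IsFundamentalSolution (fun t => coeffF z (v 0 t) (partialX v 0 t)) R)
    {w : EuclideanSpace ℂ (Fin m₁ ⊕ Fin m₂)}
    (hw : Tendsto (fun x => ‖actVec (u x) w‖) atTop (𝓝 0)) {T : ℝ} (hT : 0 ≤ T) :
    energy (actVec (R T) w) ≤ 0 := by
  by_contra! hpos
  -- The strip is open at the top, so height T + 1 is taken to include t = T.
  obtain ⟨C, hC⟩ := hstrip (T + 1) (by linarith)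
  obtain ⟨B, hB⟩ := exists_bound_coeffF (m₁ := m₁) (m₂ := m₂) z M C
  have hle : ∀ X, 0 ≤ X →
      energy (actVec (R T) w) ≤ (Real.exp (B * T) * ‖actVec (u X) w‖) ^ 2 := by
    intro X hX
    obtain ⟨W, S, hW0, hW, hS0, hS, hWS⟩ := hv.exists_compatible_flows hu hR hX hT
    have h1 := exp_mul_energy_actVec_le hM hz.le hW
      (fun s hs => isDichotomic_coeffG (hbound s T hs.1 hT)) w ⟨le_rfl, hX⟩
    have h2 := norm_actVec_le_exp_mul hT hS (fun t ht => hB _ _ (hbound X t hX ht.1)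
      (hC X t hX ht.1 (by linarith [ht.2]))) w
    rw [hW0] at h1
    rw [hS0] at h2
    have h3 : 1 ≤ Real.exp (2 * (z.im - M) * (X - 0)) := by
      apply Real.one_le_exp
      have := sub_pos.2 hz
      simp only [sub_zero]
      positivity
    calc energy (actVec (R T) w)
        ≤ Real.exp (2 * (z.im - M) * (X - 0)) * energy (actVec (R T) w) :=
          le_mul_of_one_le_left hpos.le h3
      _ ≤ ‖actVec (W X) w‖ ^ 2 := h1.trans (energy_le_norm_sq _)
      _ ≤ _ := by
        rw [hWS]
        gcongr
  have hlim : Tendsto (fun X => (Real.exp (B * T) * ‖actVec (u X) w‖) ^ 2) atTop (𝓝 0) := by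
    simpa using (hw.const_mul (Real.exp (B * T))).pow 2
  exact absurd (ge_of_tendsto hlim (eventually_atTop.2 ⟨0, hle⟩)) (not_le.2 hpos)

theorem tendsto_exp_neg_mul_atTop {c : ℝ} (hc : 0 < c) :
    Tendsto (fun t : ℝ => Real.exp (-c * t)) atTop (𝓝 0) :=
  Real.tendsto_exp_neg_atTop_nhds_zero.comp (tendsto_id.const_mul_atTop hc) |>.congr
    fun k => by simp

theorem tendsto_truncatedWeyl {A Y : ℝ → BlockMat m₁ m₂} {β μ : ℝ} (hμ : 0 ≤ μ) (hβ : μ < β)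
    (hY : IsFundamentalSolution A Y) (hA : ∀ s, 0 ≤ s → IsDichotomic β μ (A s))
    {φ : Matrix (Fin m₂) (Fin m₁) ℂ}
    (hφ : ∀ s, 0 ≤ s → ∀ h, energy (actVec (Y s) (graphVec φ h)) ≤ 0) :
    Tendsto (fun t => truncatedWeyl (Y t)) atTop (𝓝 φ) := by
  rw [tendsto_iff_norm_sub_tendsto_zero]
  refine squeeze_zero' (Eventually.of_forall fun _ => norm_nonneg _) ?_
    (tendsto_exp_neg_mul_atTop (mul_pos two_pos (sub_pos.2 hβ)))
  filter_upwards [eventually_ge_atTop 0] with t ht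
  exact norm_truncatedWeyl_sub_le hμ hβ.le hY hA ht fun s hs => hφ s hs.1

end Evolution

/-! ### The recovery formula -/

theorem mainTheorem5 (m₁ m₂ : ℕ) (v : ℝ → ℝ → Matrix (Fin m₁) (Fin m₂) ℂ) (M : ℝ) (hM : 0 < M)
    (hv : IsFocusingNLSSolution v)
    (hbound : ∀ x t, 0 ≤ x → 0 ≤ t → ‖v x t‖ ≤ M)
    (hstrip : ∀ c : ℝ, 0 < c → ∃ C : ℝ, ∀ x t, 0 ≤ x → 0 ≤ t → t < c → ‖partialX v x t‖ ≤ C)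
    (hboundary : ∃ C : ℝ, ∀ t, 0 < t → ‖partialX v 0 t‖ ≤ C) :
    -- the GW-function of the system at `t = 0` exists on `ℂ_M`
    (∃ φ : ℂ → Matrix (Fin m₂) (Fin m₁) ℂ, IsGWFunctionOn M (fun x => v x 0) φ) ∧
    -- `R z t` is `R(0, t, z)`
    ∃ R : ℂ → ℝ → BlockMat m₁ m₂,
      (∀ z, IsFundamentalSolution (fun t => coeffF z (v 0 t) (partialX v 0 t)) (R z)) ∧
      ∃ M₁ M₂ : ℝ, M < M₁ ∧ 0 < M₂ ∧
        -- the recovery formula for the GW-function, on whichever half-plane it is given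
        ∀ (K : ℝ) (φ : ℂ → Matrix (Fin m₂) (Fin m₁) ℂ), 0 < K →
          IsGWFunctionOn K (fun x => v x 0) φ →
          ∀ z : ℂ, M₁ < z.im → M₂ < z.re → K < z.im →
            (∀ t, 0 ≤ t → IsUnit (R z t).toBlocks₂₂.det) ∧
            Filter.Tendsto (fun t => -((R z t).toBlocks₂₂⁻¹ * (R z t).toBlocks₂₁))
              Filter.atTop (nhds (φ z)) := by
  have hv0 : ContinuousOn (fun x => v x 0) (Set.Ici 0) :=
    continuousOn_left_slice hv.continuousOn le_rfl
  have hvM : ∀ x, 0 ≤ x → ‖v x 0‖ ≤ M := fun x hx => hbound x 0 hx le_rfl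
  choose u hu using fun z => exists_linear_ode (continuousOn_coeffG hv0 z) 1
  choose R hR using fun z => exists_linear_ode
    (continuousOn_right_slice (hv.continuousOn_coeffF z) le_rfl) 1
  obtain ⟨φ₀, hφ₀, hφ₀u⟩ := exists_weylFunction hM.le hv0 hvM hu
  have hGW := isGWFunctionOn_of_energy_nonpos hM.le hvM hu hφ₀ hφ₀u
  obtain ⟨C₁, hC₁⟩ := hboundary
  -- The boundary bound leaves out t = 0; the strip bound covers it.
  obtain ⟨C₂, hC₂⟩ := hstrip 1 one_pos
  set C := max C₁ C₂
  have hC : ∀ t, 0 ≤ t → ‖partialX v 0 t‖ ≤ C := fun t ht => by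
    rcases ht.eq_or_lt with rfl | ht
    · exact (hC₂ 0 0 le_rfl le_rfl one_pos).trans (le_max_right _ _)
    · exact (hC₁ t ht).trans (le_max_left _ _)
  have hC0 : 0 ≤ C := (norm_nonneg _).trans (hC 0 le_rfl)
  -- If a = Re z and b = Im z both exceed 2M + C + 1, then 2ab > (a + b)(2M + C + 1) > |z| M + C/2,
  -- so F is dichotomic with a gap.
  refine ⟨⟨φ₀, hGW⟩, R, hR, 2 * M + C + 1, 2 * M + C + 1, by linarith, by linarith,
    fun K φ _ hφ z hz hz' hzK => ?_⟩
  have hzM : M < z.im := by linarith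
  have hμ : 0 ≤ ‖z‖ * M + C / 2 := by positivity
  have hβ : ‖z‖ * M + C / 2 < 2 * z.re * z.im := by
    have h1 : ‖z‖ ≤ z.re + z.im := by
      have := Complex.norm_le_abs_re_add_abs_im z
      rwa [abs_of_pos (by linarith), abs_of_pos (by linarith)] at this
    have h2 := mul_le_mul_of_nonneg_right h1 hM.le
    nlinarith
  have hA : ∀ t, 0 ≤ t → IsDichotomic (2 * z.re * z.im) (‖z‖ * M + C / 2)
      (coeffF z (v 0 t) (partialX v 0 t)) := fun t ht =>
    isDichotomic_coeffF (hbound 0 t le_rfl ht) (hC t ht)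
  refine ⟨fun t ht => isUnit_det_toBlocks₂₂ ht hμ hβ.le (hR z) hA, ?_⟩
  -- The bounds of an arbitrary GW-function depend on l and say nothing about x → ∞; uniqueness
  -- passes to `φ₀`, for which the cone gives decay of u(x)[h; φ₀h].
  rw [gwFunction_unique hM.le hv0 hvM hφ hGW hzK hzM hzM]
  refine tendsto_truncatedWeyl hμ hβ (hR z) hA fun t ht h => ?_
  refine hv.energy_actVec_nonpos hM.le hbound hstrip hzM (hu z) (hR z) ?_ ht
  have hlim := ((tendsto_exp_neg_mul_atTop (sub_pos.2 hzM)).mul_const ‖h‖).const_mul 2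
  rw [zero_mul, mul_zero] at hlim
  refine squeeze_zero' (Filter.Eventually.of_forall fun _ => norm_nonneg _) ?_ hlim
  filter_upwards [Filter.eventually_ge_atTop 0] with x hx
  exact norm_actVec_graphVec_le hx hM.le (hu z) (fun s hs => isDichotomic_coeffG (hvM s hs))
    fun s hs => hφ₀u z hzM s hs h
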